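/- Let $N\ge1$, $T>0$, and let $\mathbf f\in C^1(\mathbb R;\mathbb R^N)$ be Lipschitz continuous. Let $(\Omega,\mathcal F,\mathbb P)$ be a probability space carrying a sequence $(\beta_k)_{k}$ of independent standard Brownian motions, and let $(\mathcal F_t)_{t\ge0}$ be the completion of the filtration they generate. Let $\operatorname{AP}(\mathbb R^N)$ be the uniform closure of the real trigonometric polynomials (linear combinations of $\cos 2\pi\lambda\cdot x$, $\sin2\pi\lambda\cdot x$, $\lambda\in\mathbb R^N$). Let $g_k\in C^2(\mathbb R^N)$ have all derivatives of order $\le2$ in $\operatorname{AP}(\mathbb R^N)$, and suppose there are $\alpha_k>0$ with $\sum_k(\alpha_k+\alpha_k^2)<\infty$ and $|g_k(x)|+|\nabla g_k(x)|+|\nabla^2g_k(x)|\le\alpha_k$ for all $k$ and $x$. Put $J(t,x)=\sum_k g_k(x)\beta_k(t)$. With $C_R=\{x:|x_i|\le R/2,\ i=1,\dots,N\}$ let $N_1(v)=\limsup_{R\to\infty}R^{-N}\int_{C_R}|v|\,dx$, and let $\mathcal B^1(\mathbb R^N)$ be the completion of $\operatorname{AP}(\mathbb R^N)$ with respect to $N_1$;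 thus $v\in L^1_{\rm loc}$ belongs to $\mathcal B^1$ if it is an $N_1$-limit of functions in $\operatorname{AP}(\mathbb R^N)$. For a deterministic $u_0\in L^\infty\cap\mathcal B^1(\mathbb R^N)$, a BAP-entropy solution of $$du+\operatorname{div}\mathbf f(u)\,dt=\sum_k g_k\,d\beta_k,\qquad u(0,\cdot)=u_0,\qquad (t,x)\in(0,T)\times\mathbb R^N,$$ is an $(\mathcal F_t)$-adapted, $L^1_{\rm loc}\cap\mathcal B^1(\mathbb R^N)$-valued process $u$ such that, almost surely: (1) $t\mapsto u(t)$ is weakly continuous on $[0,T]$ in $L^1_{\rm loc}\cap\mathcal B^1(\mathbb R^N)$; (2) $u\in L^\infty([0,T];L^1_{\rm loc}\cap\mathcal B^1(\mathbb R^N))$; (3) with $w=u-J$, for all $0\le\varphi\in C_c^\infty((-T,T)\times\mathbb R^N)$ and all $\alpha\in\mathbb R$, $$\int_0^T\!\!\int_{\mathbb R^N}\Big\{(|w-\alpha|-|u_0-\alpha|)\varphi_t+\operatorname{sgn}(w-\alpha)\big(\mathbf f(w+J)-\mathbf f(\alpha+J)\big)\cdot\nabla\varphi-\operatorname{sgn}(w-\alpha)\,\mathbf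 f'(\alpha+J)\cdot\nabla J\,\varphi\Big\}\,dx\,dt\ge0 .$$ Let $\rho_*(x)=C_Ne^{-\sqrt{1+|x|^2}}$ with $C_N$ such that $\int_{\mathbb R^N}\rho_*\,dx=1$. Then there is a constant $C>0$, depending only on $T$ and $\mathbf f$ (in particular not on $\omega$), such that for any two BAP-entropy solutions $u,\hat u$ (on the same probability space, with the same $\beta_k$ and $g_k$) with initial data $u_0,\hat u_0$: almost surely, for a.e. $t\in[0,T]$, the left-hand side below is finite and $$\int_{\mathbb R^N}|u(t,x)-\hat u(t,x)|\,\rho_*(x)\,dx\le C\int_{\mathbb R^N}|u_0(x)-\hat u_0(x)|\,\rho_*(x)\,dx .$$ In particular, if $u_0=\hat u_0$ a.e., then almost surely $u(t,\cdot)=\hat u(t,\cdot)$ a.e. in $\mathbb R^N$ for every $t\in[0,T]$. -/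

import Mathlib

open MeasureTheory ProbabilityTheory Filter Set
open scoped NNReal ENNReal Topology

noncomputable section

namespace BAP

/-- The Euclidean space `ℝ^N`. -/
abbrev E (N : ℕ) : Type := EuclideanSpace ℝ (Fin N)

/-- The weight `ρ_*(x) = C_N exp(-√(1 + |x|²))`, with `C_N` normalizing its integral to `1`. -/
def rhoStar (N : ℕ) (x : E N) : ℝ :=
  (∫ y : E N, Real.exp (-√(1 + ‖y‖ ^ 2)))⁻¹ * Real.exp (-√(1 + ‖x‖ ^ 2))

/-! ### Almost periodic functions -/

/-- Real trigonometric polynomials on `ℝ^N`. -/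
def trigPoly (N : ℕ) : Submodule ℝ (E N → ℝ) :=
  Submodule.span ℝ
    ({p | ∃ l : E N, p = fun x => Real.cos (2 * Real.pi * inner ℝ l x)} ∪
      {p | ∃ l : E N, p = fun x => Real.sin (2 * Real.pi * inner ℝ l x)})

/-- `AP(ℝ^N)`: uniform limits of trigonometric polynomials. -/
def IsAP {N : ℕ} (g : E N → ℝ) : Prop :=
  ∀ ε : ℝ, 0 < ε → ∃ p ∈ trigPoly N, ∀ x, |g x - p x| ≤ ε

/-- `AP²(ℝ^N)`: functions of class `C²` all of whose derivatives of order at most two (in arbitrary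
directions) are almost periodic. -/
def IsAP2 {N : ℕ} (g : E N → ℝ) : Prop :=
  ContDiff ℝ 2 g ∧
    ∀ i : ℕ, i ≤ 2 → ∀ m : Fin i → E N, IsAP (fun x => iteratedFDeriv ℝ i g x m)

/-- The cube `C_R` of side `R` centred at the origin. -/
def cube (N : ℕ) (R : ℝ) : Set (E N) := {x | ∀ i, |x i| ≤ R / 2}

/-- The Besicovitch seminorm `N_1(v) = limsup_{R → ∞} R^{-N} ∫_{C_R} |v|`, with values in
`[0, ∞]`. -/
def besicovitchNorm {N : ℕ} (v : E N → ℝ) : ℝ≥0∞ :=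
  limsup (fun R : ℝ => (∫⁻ x in cube N R, ‖v x‖ₑ) / ENNReal.ofReal (R ^ N)) atTop

/-- Membership in `L¹_loc ∩ B¹(ℝ^N)`: locally integrable functions that are limits of almost
periodic functions with respect to `N_1`. -/
def MemL1locB1 {N : ℕ} (v : E N → ℝ) : Prop :=
  LocallyIntegrable v volume ∧
    ∀ ε : ℝ, 0 < ε → ∃ g : E N → ℝ, IsAP g ∧
      besicovitchNorm (fun x => v x - g x) ≤ ENNReal.ofReal ε

/-! ### The noise -/

/-- The standing assumptions on the noise coefficients `g_k`. -/
structure IsNoiseCoeff {N : ℕ} (g : ℕ → E N → ℝ) : Prop where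
  ap2 : ∀ k, IsAP2 (g k)
  bound : ∃ a : ℕ → ℝ, (∀ k, 0 < a k) ∧ Summable (fun k => a k + a k ^ 2) ∧
    ∀ k x, |g k x| + ‖fderiv ℝ (g k) x‖ + ‖iteratedFDeriv ℝ 2 (g k) x‖ ≤ a k

/-- A sequence of independent real standard Brownian motions. -/
structure IsBrownianSeq {Ω : Type*} [MeasurableSpace Ω] (P : Measure Ω)
    (β : ℕ → ℝ≥0 → Ω → ℝ) : Prop where
  measurable : ∀ k t, Measurable (β k t)
  brownian : ∀ k, IsBrownianReal (β k) P
  indep : iIndepFun (fun k ω t => β k t ω) P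

/-- The `σ`-algebra `𝓕_t` of the completed canonical filtration of `(β_k)`: the sets that agree,
up to a `P`-null set, with an event generated by `β_k(s)`, `k ∈ ℕ`, `s ≤ t`. -/
abbrev noiseSigma {Ω : Type*} [MeasurableSpace Ω] (P : Measure Ω) (β : ℕ → ℝ≥0 → Ω → ℝ)
    (t : ℝ≥0) : MeasurableSpace Ω :=
  eventuallyMeasurableSpace
    (⨆ k : ℕ, ⨆ s : ℝ≥0, ⨆ _ : s ≤ t, MeasurableSpace.comap (β k s) (borel ℝ)) (ae P)

/-- `J(t, x) = ∑_k g_k(x) β_k(t)` along the path `ω` (for `t ≥ 0`). -/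
def noiseJ {N : ℕ} {Ω : Type*} (g : ℕ → E N → ℝ) (β : ℕ → ℝ≥0 → Ω → ℝ)
    (ω : Ω) (t : ℝ) (x : E N) : ℝ :=
  ∑' k, g k x * β k t.toNNReal ω

/-! ### Entropy solutions -/

/-- Weak continuity on `[0, T]` in `L¹_loc ∩ B¹(ℝ^N)`. The dual of `L¹_loc` consists of the bounded
compactly supported functions. A continuous functional on `B¹` is determined by its restriction to
the dense space `L¹_loc ∩ B¹`; it is represented here by an arbitrary linear extension `ℓ` to all
functions, and only its values on `L¹_loc ∩ B¹` matter. -/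
structure IsWeaklyContinuous {N : ℕ} (T : ℝ) (u : ℝ → E N → ℝ) : Prop where
  loc : ∀ ψ : E N → ℝ, Measurable ψ → (∃ c, ∀ x, |ψ x| ≤ c) → HasCompactSupport ψ →
    ContinuousOn (fun t => ∫ x, u t x * ψ x) (Icc 0 T)
  besicovitch : ∀ ℓ : (E N → ℝ) →ₗ[ℝ] ℝ,
    (∃ c : ℝ≥0, ∀ v, MemL1locB1 v → ENNReal.ofReal |ℓ v| ≤ c * besicovitchNorm v) →
    ContinuousOn (fun t => ℓ (u t)) (Icc 0 T)

/-- `u ∈ L^∞([0, T]; L¹_loc ∩ B¹(ℝ^N))`. -/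
structure IsEssBounded {N : ℕ} (T : ℝ) (u : ℝ → E N → ℝ) : Prop where
  measurable : AEStronglyMeasurable (fun p : ℝ × E N => u p.1 p.2)
    ((volume.restrict (Icc 0 T)).prod volume)
  loc : ∀ K : Set (E N), IsCompact K → ∃ M : ℝ, ∀ᵐ t ∂(volume.restrict (Icc 0 T)),
    ∫⁻ x in K, ‖u t x‖ₑ ≤ ENNReal.ofReal M
  besicovitch : ∃ M : ℝ, ∀ᵐ t ∂(volume.restrict (Icc 0 T)),
    besicovitchNorm (u t) ≤ ENNReal.ofReal M

/-- The Kruzhkov entropy inequalities for `w = u - J`, with initial datum `u₀`. -/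
def EntropyInequality {N : ℕ} (T : ℝ) (f : ℝ → E N) (u₀ : E N → ℝ) (J u : ℝ → E N → ℝ) : Prop :=
  ∀ φ : ℝ × E N → ℝ, ContDiff ℝ (⊤ : ℕ∞) φ → HasCompactSupport φ →
    tsupport φ ⊆ Ioo (-T) T ×ˢ univ → (∀ p, 0 ≤ φ p) → ∀ α : ℝ,
    0 ≤ ∫ t in Icc 0 T, ∫ x,
      ((|(u t x - J t x) - α| - |u₀ x - α|) * deriv (fun s => φ (s, x)) t
        + Real.sign ((u t x - J t x) - α) *
            inner ℝ (f ((u t x - J t x) + J t x) - f (α + J t x))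
              (gradient (fun y => φ (t, y)) x)
        - Real.sign ((u t x - J t x) - α) *
            inner ℝ (deriv f (α + J t x)) (gradient (J t) x) * φ (t, x))

/-- `u` is a Besicovitch almost periodic entropy solution on `[0, T]` of
`du + div f(u) dt = Φ dW`, `u(0) = u₀`, where `Φ dW = ∑_k g_k dβ_k`. -/
structure IsBAPEntropySolution {N : ℕ} {Ω : Type*} [MeasurableSpace Ω] (P : Measure Ω)
    (β : ℕ → ℝ≥0 → Ω → ℝ) (g : ℕ → E N → ℝ) (f : ℝ → E N) (T : ℝ) (u₀ : E N → ℝ)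
    (u : ℝ → Ω → E N → ℝ) : Prop where
  init_bounded : MemLp u₀ ∞ volume
  init_bap : MemL1locB1 u₀
  /-- Adaptedness; the Borel `σ`-algebra of `L¹_loc` is generated by integration against continuous
  compactly supported functions. -/
  adapted : ∀ t ∈ Icc 0 T, ∀ ψ : E N → ℝ, Continuous ψ → HasCompactSupport ψ →
    Measurable[noiseSigma P β t.toNNReal] (fun ω => ∫ x, u t ω x * ψ x)
  mem : ∀ᵐ ω ∂P, ∀ t ∈ Icc 0 T, MemL1locB1 (u t ω)
  weakly_continuous : ∀ᵐ ω ∂P, IsWeaklyContinuous T (fun t => u t ω)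
  ess_bounded : ∀ᵐ ω ∂P, IsEssBounded T (fun t => u t ω)
  entropy : ∀ᵐ ω ∂P, EntropyInequality T f u₀ (noiseJ g β ω) (fun t => u t ω)

end BAP

end

/-! The noise is additive, so for a fixed path `w = u - J` is a Kruzhkov entropy solution of `w_t +
div f(w + J) = 0`, a scalar law whose flux depends on `(t, x)` through `J`. The estimate is
therefore proved path by path, as weighted L¹ contraction with finite speed of propagation.

Initial data: `w` is extended to `t < 0` by `u₀` and the flux is switched off there by the factor
`heav`. The entropy inequality then holds on all of `(-T, T)` with no initial term
(`exists_isKruzhkov`), so no strong trace at `t = 0` is needed; the price is a flux that jumps in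
time.

Kato inequality (`kato_inequality`): two solutions are compared by doubling variables, with
mollification scales `ε` in time and `h` in space. The flux increment between `p` and `p - (ετ, hz)`
is divided by `h`. Its spatial part is a difference quotient of `J` and converges. Its temporal part
has no rate, since neither `J` nor `heav` is assumed regular in time; but it tends to zero as `ε →
0` for fixed `h`, so `ε` is chosen after `h` (`exists_scales_discrepancy_le`). In the limit,
integrating by parts in the mollifier turns the spatial part into minus the difference of the source
terms, and the two cancel exactly (`integral_limitDoubled`). What remains is `∂_t |w - v| + div
(sgn(w - v)(F(w) - F(v))) ≤ 0`, with no trace of `∇J`; this is why the final constant does not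
depend on the path.

Weight (`weighted_estimate`): testing with a truncation of `exp(-(√(1+|x|²) + Lt))`, which decreases
in time fast enough to absorb a flux of speed at most `L`, gives a nonincreasing weighted distance.
Comparing a time in `(0, T)` with times in `(-T, 0)`, and inserting and removing the factor
`e^{Lt}`, costs `e^{LT}` twice.

Noise (`ae_continuous_and_lintegral_brownianSeq_lt_top`, `exists_hasSpatialGradient_noise`): all
that is required of a path is that `∑ a_k |β_k(t)|` be integrable in `t`, which first moments and
Tonelli provide. Equality at every time follows from equality at almost every time by weak
continuity. -/

noncomputable section

namespace BAP

variable {N : ℕ}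

/-! ### Continuity of translations and dominated sequences in L¹ -/

section Translation

variable {V H : Type*} [NormedAddCommGroup V] [NormedSpace ℝ V] [FiniteDimensional ℝ V]
  [MeasurableSpace V] [BorelSpace V] {μ : Measure V} [μ.IsAddHaarMeasure]
  [NormedAddCommGroup H]

/-- Translations act continuously on `L¹`. -/
theorem tendsto_lintegral_enorm_translate_sub {F : V → H} (hF : Integrable F μ) :
    Tendsto (fun v => ∫⁻ p, ‖F (p - v) - F p‖ₑ ∂μ) (𝓝 0) (𝓝 0) := by
  have hp : Fact ((1 : ℝ≥0∞) ≤ 1) := ⟨le_rfl⟩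
  have hmp : ∀ v : V, MeasurePreserving (fun p => p - v) μ μ := fun v =>
    measurePreserving_sub_right μ v
  let g : V → C(V, V) := fun v => ⟨fun p => p - v, by fun_prop⟩
  have hg : Continuous g := by
    apply ContinuousMap.continuous_of_continuous_uncurry
    exact (continuous_snd.sub continuous_fst)
  have hF1 : MemLp F 1 μ := memLp_one_iff_integrable.2 hF
  have key := (tendsto_const_nhds (x := hF1.toLp F) (f := 𝓝 (0 : V))).compMeasurePreservingLp
    hg.continuousAt.tendsto (fun v => hmp v) (hmp 0) ENNReal.one_ne_top
  rw [tendsto_iff_edist_tendsto_0] at key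
  refine key.congr fun v => ?_
  rw [Lp.edist_def, eLpNorm_one_eq_lintegral_enorm]
  refine lintegral_congr_ae ?_
  have h1 := Lp.coeFn_compMeasurePreserving (hF1.toLp F) (hmp v)
  have h0 := Lp.coeFn_compMeasurePreserving (hF1.toLp F) (hmp 0)
  have h2 := (hmp v).quasiMeasurePreserving.ae hF1.coeFn_toLp
  have h3 := (hmp 0).quasiMeasurePreserving.ae hF1.coeFn_toLp
  filter_upwards [h1, h0, h2, h3] with p e1 e0 e2 e3
  change ‖Lp.compMeasurePreserving (fun p => p - v) (hmp v) (hF1.toLp F) p -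
    Lp.compMeasurePreserving (fun p => p - 0) (hmp 0) (hF1.toLp F) p‖ₑ = _
  rw [e1, e0]
  simp only [Function.comp_apply]
  rw [e2, e3, sub_zero]

/-- Translations act continuously on `L¹_loc`. -/
theorem tendsto_setLIntegral_enorm_translate_sub {F : V → H} (hF : LocallyIntegrable F μ)
    {K : Set V} (hK : IsCompact K) :
    Tendsto (fun v => ∫⁻ p in K, ‖F (p - v) - F p‖ₑ ∂μ) (𝓝 0) (𝓝 0) := by
  have hK1 : IsCompact (Metric.cthickening 1 K) := hK.cthickening
  -- For `p ∈ K` and `‖v‖ ≤ 1` both `p` and `p - v` lie in the 1-thickening, so truncating there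
  -- does not change the increment.
  have hI : Integrable ((Metric.cthickening 1 K).indicator F) μ :=
    (integrable_indicator_iff hK1.measurableSet).2 (hF.integrableOn_isCompact hK1)
  refine tendsto_of_tendsto_of_tendsto_of_le_of_le' tendsto_const_nhds
    (tendsto_lintegral_enorm_translate_sub hI) (Eventually.of_forall fun _ => zero_le) ?_
  filter_upwards [Metric.closedBall_mem_nhds (0 : V) one_pos] with v hv
  rw [mem_closedBall_zero_iff] at hv
  refine le_trans (le_of_eq ?_) (setLIntegral_le_lintegral K _)
  refine setLIntegral_congr_fun hK.measurableSet fun p hp => ?_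
  have h1 : p ∈ Metric.cthickening 1 K := Metric.self_subset_cthickening K hp
  have h2 : p - v ∈ Metric.cthickening 1 K :=
    Metric.mem_cthickening_of_dist_le _ p _ _ hp (by simpa [dist_eq_norm] using hv)
  simp only [indicator_of_mem h1, indicator_of_mem h2]

end Translation

/-- A sequence that is summable in `L¹` tends to zero almost everywhere and has an integrable
majorant. -/
theorem exists_integrable_bound_of_lintegral_le_geometric {α : Type*} [MeasurableSpace α]
    {μ : Measure α} {X : ℕ → α → ℝ} (hX : ∀ n, AEMeasurable (X n) μ) (h0 : ∀ n a, 0 ≤ X n a)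
    (hsum : ∀ n, ∫⁻ a, ENNReal.ofReal (X n a) ∂μ ≤ ENNReal.ofReal ((1 / 2) ^ n)) :
    ∃ Y : α → ℝ, Integrable Y μ ∧ (∀ᵐ a ∂μ, ∀ n, X n a ≤ Y a) ∧
      ∀ᵐ a ∂μ, Tendsto (fun n => X n a) atTop (𝓝 0) := by
  have hm : ∀ n, AEMeasurable (fun a => ENNReal.ofReal (X n a)) μ :=
    fun n => (hX n).ennreal_ofReal
  have hfin : ∫⁻ a, ∑' n, ENNReal.ofReal (X n a) ∂μ ≠ ∞ := by
    rw [lintegral_tsum hm]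
    refine ne_top_of_le_ne_top ?_ (ENNReal.tsum_le_tsum hsum)
    rw [← ENNReal.ofReal_tsum_of_nonneg (fun n => by positivity) summable_geometric_two]
    exact ENNReal.ofReal_ne_top
  have hae := ae_lt_top' (AEMeasurable.tsum hm) hfin
  have hsumm : ∀ᵐ a ∂μ, Summable fun n => X n a := by
    filter_upwards [hae] with a ha
    have := ENNReal.summable_toReal ha.ne
    simpa only [ENNReal.toReal_ofReal (h0 _ a)] using this
  refine ⟨fun a => (∑' n, ENNReal.ofReal (X n a)).toReal,
    integrable_toReal_of_lintegral_ne_top (AEMeasurable.tsum hm) hfin, ?_, ?_⟩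
  · filter_upwards [hae] with a ha n
    rw [← ENNReal.ofReal_le_iff_le_toReal ha.ne]
    exact ENNReal.le_tsum n
  · filter_upwards [hsumm] with a ha using ha.tendsto_atTop_zero

/-! ### Anisotropic dilations of space-time -/

section Dilation

instance isAddHaarMeasure_volume_prod : (volume : Measure (ℝ × E N)).IsAddHaarMeasure :=
  inferInstanceAs ((volume : Measure ℝ).prod (volume : Measure (E N))).IsAddHaarMeasure

/-- The dilation `(t, x) ↦ (ε t, h x)`. -/
def dil (N : ℕ) (ε h : ℝ) : (ℝ × E N) →L[ℝ] (ℝ × E N) :=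
  (ε • ContinuousLinearMap.fst ℝ ℝ (E N)).prod (h • ContinuousLinearMap.snd ℝ ℝ (E N))

@[simp] theorem dil_apply (ε h : ℝ) (r : ℝ × E N) : dil N ε h r = (ε * r.1, h • r.2) := rfl

theorem dil_inv_dil {ε h : ℝ} (hε : ε ≠ 0) (hh : h ≠ 0) (r : ℝ × E N) :
    dil N ε⁻¹ h⁻¹ (dil N ε h r) = r := by
  ext <;> simp [hε, hh]

theorem norm_dil_le {ε h : ℝ} (hε : 0 ≤ ε) (hεh : ε ≤ h) (r : ℝ × E N) :
    ‖dil N ε h r‖ ≤ h * ‖r‖ := by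
  have hh : 0 ≤ h := hε.trans hεh
  rw [dil_apply, Prod.norm_def]
  refine max_le ?_ ?_
  · rw [norm_mul, Real.norm_of_nonneg hε]
    exact mul_le_mul hεh (norm_fst_le r) (norm_nonneg _) hh
  · rw [norm_smul, Real.norm_of_nonneg hh]
    exact mul_le_mul_of_nonneg_left (norm_snd_le r) hh

/-- Change of variables `q = p - (ε τ, h z)`. -/
theorem exists_integral_eq_mul_integral_dil {ε h : ℝ} (hε : 0 < ε) (hh : 0 < h) :
    ∃ c : ℝ, 0 < c ∧ ∀ (g : ℝ × E N → ℝ) (p : ℝ × E N),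
      ∫ q, g q = c * ∫ r, g (p - dil N ε h r) := by
  let e : (ℝ × E N) ≃ₗ[ℝ] (ℝ × E N) := LinearEquiv.ofLinearMap (dil N ε h).toLinearMap
    (dil N ε⁻¹ h⁻¹).toLinearMap
    (by
      refine LinearMap.ext fun r => ?_
      have := dil_inv_dil (inv_ne_zero hε.ne') (inv_ne_zero hh.ne') r
      rw [inv_inv, inv_inv] at this
      exact this)
    (by
      refine LinearMap.ext fun r => ?_
      exact dil_inv_dil hε.ne' hh.ne' r)
  have hdet : LinearMap.det (e : (ℝ × E N) →ₗ[ℝ] (ℝ × E N)) ≠ 0 := e.isUnit_det'.ne_zero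
  have hmap := Measure.map_linearMap_addHaar_eq_smul_addHaar
    (volume : Measure (ℝ × E N)) hdet
  -- The Jacobian is left unevaluated: only its positivity and its independence of `g` and `p`
  -- matter.
  refine ⟨|LinearMap.det (e : (ℝ × E N) →ₗ[ℝ] (ℝ × E N))|, abs_pos.2 hdet, fun g p => ?_⟩
  have hemb : MeasurableEmbedding (e : (ℝ × E N) → (ℝ × E N)) :=
    e.toContinuousLinearEquiv.toHomeomorph.measurableEmbedding
  have h1 : ∫ r, g (p - dil N ε h r) = ∫ q, g (p - q) ∂(volume.map e) :=
    (hemb.integral_map (fun q => g (p - q))).symm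
  have h2 : (volume : Measure (ℝ × E N)).map e = volume.map
    (e : (ℝ × E N) →ₗ[ℝ] (ℝ × E N)) := rfl
  rw [h1, h2, hmap, integral_smul_measure, integral_sub_left_eq_self,
    ENNReal.toReal_ofReal (abs_nonneg _), smul_eq_mul, ← mul_assoc, abs_inv,
    mul_inv_cancel₀ (abs_ne_zero.2 hdet), one_mul]

end Dilation

/-! ### The sign function -/

theorem abs_sign_le_one (r : ℝ) : |Real.sign r| ≤ 1 := by
  rcases Real.sign_apply_eq r with h | h | h <;> simp [h]

theorem measurable_sign : Measurable Real.sign :=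
  Measurable.ite measurableSet_Iio measurable_const
    (Measurable.ite measurableSet_Ioi measurable_const measurable_const)

theorem sign_sub_comm (a b : ℝ) : Real.sign (b - a) = -Real.sign (a - b) := by
  rw [← Real.sign_neg, neg_sub]

/-- A product with a sign is continuous if the other factor vanishes where the sign jumps. -/
theorem tendsto_sign_smul {ι F : Type*} [NormedAddCommGroup F] [NormedSpace ℝ F] {l : Filter ι}
    {s : ι → ℝ} {y : ι → F} {s₀ : ℝ} {y₀ : F} (hs : Tendsto s l (𝓝 s₀)) (hy : Tendsto y l (𝓝 y₀))
    (h0 : s₀ = 0 → y₀ = 0) :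
    Tendsto (fun i => Real.sign (s i) • y i) l (𝓝 (Real.sign s₀ • y₀)) := by
  rcases lt_trichotomy s₀ 0 with h | h | h
  · refine Tendsto.congr' ?_ ((tendsto_const_nhds (x := Real.sign s₀)).smul hy)
    filter_upwards [hs.eventually (gt_mem_nhds h)] with i hi
    rw [Real.sign_of_neg h, Real.sign_of_neg hi]
  · rw [h0 h, smul_zero]
    rw [h0 h] at hy
    refine squeeze_zero_norm (fun i => ?_) (tendsto_zero_iff_norm_tendsto_zero.1 hy)
    rw [norm_smul]
    exact mul_le_of_le_one_left (norm_nonneg _) (abs_sign_le_one _)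
  · refine Tendsto.congr' ?_ ((tendsto_const_nhds (x := Real.sign s₀)).smul hy)
    filter_upwards [hs.eventually (lt_mem_nhds h)] with i hi
    rw [Real.sign_of_pos h, Real.sign_of_pos hi]

/-! ### Space-time form of the entropy inequalities -/

/-- The indicator of `{t ≥ 0}`. -/
def heav (p : ℝ × E N) : ℝ := if 0 ≤ p.1 then 1 else 0

/-- The flux `1_{t ≥ 0} f(a + J)`. -/
def flux (f : ℝ → E N) (J : ℝ × E N → ℝ) (p : ℝ × E N) (a : ℝ) : E N := heav p • f (a + J p)

/-- The spatial divergence `1_{t ≥ 0} f'(a + J) · G` of the flux, where `G` is the gradient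
of `J`. -/
def source (f : ℝ → E N) (J : ℝ × E N → ℝ) (G : ℝ × E N → E N) (p : ℝ × E N) (a : ℝ) : ℝ :=
  heav p * inner ℝ (deriv f (a + J p)) (G p)

/-- The space-time Kruzhkov entropy flux. -/
def kflux (f : ℝ → E N) (J : ℝ × E N → ℝ) (p : ℝ × E N) (a b : ℝ) : ℝ × E N :=
  (|a - b|, Real.sign (a - b) • (flux f J p a - flux f J p b))

/-- The Kruzhkov entropy inequalities on `(-T, T) × ℝ^N` for the flux that vanishes
for `t < 0`. -/
def IsKruzhkov (T : ℝ) (f : ℝ → E N) (J : ℝ × E N → ℝ) (G : ℝ × E N → E N)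
    (w : ℝ × E N → ℝ) : Prop :=
  ∀ φ : ℝ × E N → ℝ, ContDiff ℝ (⊤ : ℕ∞) φ → HasCompactSupport φ →
    tsupport φ ⊆ Ioo (-T) T ×ˢ univ → (∀ p, 0 ≤ φ p) → ∀ α : ℝ,
    0 ≤ ∫ p, (fderiv ℝ φ p (kflux f J p (w p) α)
      - Real.sign (w p - α) * source f J G p α * φ p)

theorem heav_nonneg (p : ℝ × E N) : 0 ≤ heav p := by
  unfold heav; split_ifs <;> norm_num

theorem heav_le_one (p : ℝ × E N) : heav p ≤ 1 := by
  unfold heav; split_ifs <;> norm_num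

theorem abs_heav_le_one (p : ℝ × E N) : |heav p| ≤ 1 := by
  rw [abs_of_nonneg (heav_nonneg p)]; exact heav_le_one p

theorem measurable_heav : Measurable (heav : ℝ × E N → ℝ) :=
  Measurable.ite (measurableSet_le measurable_const measurable_fst) measurable_const
    measurable_const

theorem kflux_comm (f : ℝ → E N) (J : ℝ × E N → ℝ) (p : ℝ × E N) (a b : ℝ) :
    kflux f J p a b = kflux f J p b a := by
  unfold kflux
  rw [abs_sub_comm, sign_sub_comm b a, neg_smul, ← smul_neg, neg_sub]

section Bounds

variable {f : ℝ → E N} {L : ℝ≥0} {J : ℝ × E N → ℝ} {G : ℝ × E N → E N}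

theorem norm_flux_sub_le (hL : LipschitzWith L f) (p : ℝ × E N) (a b : ℝ) :
    ‖flux f J p a - flux f J p b‖ ≤ L * |a - b| := by
  unfold flux
  rw [← smul_sub, norm_smul]
  refine (mul_le_of_le_one_left (norm_nonneg _) (abs_heav_le_one p)).trans ?_
  simpa [Real.norm_eq_abs] using hL.norm_sub_le (a + J p) (b + J p)

theorem norm_kflux_le (hL : LipschitzWith L f) (p : ℝ × E N) (a b : ℝ) :
    ‖kflux f J p a b‖ ≤ (1 + L) * (|a| + |b|) := by
  have hab : |a - b| ≤ |a| + |b| := abs_sub a b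
  have h0 := abs_nonneg (a - b)
  have hL0 : (0 : ℝ) ≤ L := L.2
  rw [Prod.norm_def]
  refine max_le ?_ ?_
  · simp only [kflux, Real.norm_eq_abs, abs_abs]
    nlinarith
  · simp only [kflux, norm_smul, Real.norm_eq_abs]
    refine (mul_le_of_le_one_left (norm_nonneg _) (abs_sign_le_one _)).trans
      ((norm_flux_sub_le hL p a b).trans ?_)
    nlinarith

theorem norm_deriv_le (hL : LipschitzWith L f) (a : ℝ) : ‖deriv f a‖ ≤ L :=
  norm_deriv_le_of_lipschitz hL

theorem abs_source_le (hL : LipschitzWith L f) (p : ℝ × E N) (a : ℝ) :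
    |source f J G p a| ≤ L * ‖G p‖ := by
  unfold source
  rw [abs_mul]
  refine (mul_le_of_le_one_left (abs_nonneg _) (abs_heav_le_one p)).trans
    ((abs_real_inner_le_norm _ _).trans ?_)
  exact mul_le_mul_of_nonneg_right (norm_deriv_le hL _) (norm_nonneg _)

end Bounds

section Measurability

variable {α : Type*} [MeasurableSpace α] {f : ℝ → E N} {J : ℝ × E N → ℝ} {G : ℝ × E N → E N}

theorem measurable_flux (hf : Continuous f) (hJ : Measurable J) {p : α → ℝ × E N} {a : α → ℝ}
    (hp : Measurable p) (ha : Measurable a) : Measurable fun i => flux f J (p i) (a i) :=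
  (measurable_heav.comp hp).smul (hf.measurable.comp (ha.add (hJ.comp hp)))

theorem measurable_kflux (hf : Continuous f) (hJ : Measurable J) {p : α → ℝ × E N} {a b : α → ℝ}
    (hp : Measurable p) (ha : Measurable a) (hb : Measurable b) :
    Measurable fun i => kflux f J (p i) (a i) (b i) :=
  Measurable.prodMk (ha.sub hb).abs
    ((measurable_sign.comp (ha.sub hb)).smul
      ((measurable_flux hf hJ hp ha).sub (measurable_flux hf hJ hp hb)))

theorem measurable_source (hf : ContDiff ℝ 1 f) (hJ : Measurable J) (hG : Measurable G)
    {p : α → ℝ × E N} {a : α → ℝ} (hp : Measurable p) (ha : Measurable a) :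
    Measurable fun i => source f J G (p i) (a i) :=
  (measurable_heav.comp hp).mul
    (((hf.continuous_deriv le_rfl).measurable.comp (ha.add (hJ.comp hp))).inner (hG.comp hp))

theorem measurable_clm_apply {A : α → (ℝ × E N) →L[ℝ] ℝ} {y : α → ℝ × E N}
    (hA : Measurable A) (hy : Measurable y) : Measurable fun i => A i (y i) :=
  isBoundedBilinearMap_apply.continuous.measurable.comp (hA.prodMk hy)

end Measurability

theorem locallyIntegrable_norm {X H : Type*} [TopologicalSpace X] [MeasurableSpace X]
    {μ : Measure X} [NormedAddCommGroup H] {k : X → H} (hk : LocallyIntegrable k μ) :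
    LocallyIntegrable (fun x => ‖k x‖) μ := fun x => by
  obtain ⟨s, hs, h⟩ := hk x
  exact ⟨s, hs, h.norm⟩

/-- The majorant is a sum of tensor products `g ⊗ 1 + 1 ⊗ g'` cut off to `K × K'`, each integrable
by Tonelli. -/
theorem integrable_of_le_on_compact_prod {c : (ℝ × E N) × (ℝ × E N) → ℝ} (hc : Measurable c)
    {K K' : Set (ℝ × E N)} (hK : IsCompact K) (hK' : IsCompact K') {g g' : ℝ × E N → ℝ}
    (hg : LocallyIntegrable g) (hg' : LocallyIntegrable g') (h0 : ∀ z, z ∉ K ×ˢ K' → c z = 0)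
    (hb : ∀ z ∈ K ×ˢ K', |c z| ≤ g z.1 + g' z.2) : Integrable c := by
  have h1 : ∀ {S : Set (ℝ × E N)}, IsCompact S →
      Integrable (S.indicator (fun _ => (1 : ℝ))) volume := fun hS =>
    (integrable_indicator_iff hS.measurableSet).2
      (integrableOn_const hS.measure_lt_top.ne)
  have h2 : ∀ {S : Set (ℝ × E N)} {k : ℝ × E N → ℝ}, IsCompact S → LocallyIntegrable k →
      Integrable (S.indicator k) volume := fun hS hk =>
    (integrable_indicator_iff hS.measurableSet).2 (hk.integrableOn_isCompact hS)
  have h3 := ((h2 hK hg).mul_prod (h1 hK')).add ((h1 hK).mul_prod (h2 hK' hg'))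
  refine Integrable.mono' h3 hc.aestronglyMeasurable (Eventually.of_forall fun z => ?_)
  by_cases hz : z ∈ K ×ˢ K'
  · simpa [indicator_of_mem hz.1, indicator_of_mem hz.2] using hb z hz
  · rw [h0 z hz, norm_zero]
    by_cases hz1 : z.1 ∈ K
    · have hz2 : z.2 ∉ K' := fun h => hz ⟨hz1, h⟩
      simp [hz2]
    · simp [hz1]

/-! ### Doubling of variables -/

/-- The integrand of the doubled entropy inequality with test function `ψ(p) η(p - q)`. -/
def doubled (f : ℝ → E N) (J : ℝ × E N → ℝ) (G : ℝ × E N → E N) (ψ η : ℝ × E N → ℝ)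
    (w v : ℝ × E N → ℝ) (p q : ℝ × E N) : ℝ :=
  η (p - q) * fderiv ℝ ψ p (kflux f J p (w p) (v q))
    + ψ p * fderiv ℝ η (p - q) (kflux f J p (w p) (v q) - kflux f J q (w p) (v q))
    - Real.sign (w p - v q) * (source f J G p (v q) - source f J G q (w p)) * (ψ p * η (p - q))

/-- Kruzhkov's doubling: for fixed `q` the inequality for `w` is used with constant `α = v q`, for
fixed `p` the one for `v` with `α = w p`, and the two are integrated in the frozen variable and
added. -/
theorem integral_doubled_nonneg {T : ℝ} {f : ℝ → E N} {L : ℝ≥0} {J : ℝ × E N → ℝ}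
    {G : ℝ × E N → E N} {ψ η w v : ℝ × E N → ℝ} (hf : ContDiff ℝ 1 f) (hL : LipschitzWith L f)
    (hJ : Measurable J) (hG : Measurable G) (hGi : LocallyIntegrable G)
    (hw : Measurable w) (hwi : LocallyIntegrable w) (hv : Measurable v)
    (hvi : LocallyIntegrable v) (hwK : IsKruzhkov T f J G w) (hvK : IsKruzhkov T f J G v)
    (hψ : ContDiff ℝ (⊤ : ℕ∞) ψ) (hψc : HasCompactSupport ψ) (hψ0 : ∀ p, 0 ≤ ψ p)
    (hη : ContDiff ℝ (⊤ : ℕ∞) η) (hηc : HasCompactSupport η) (hη0 : ∀ p, 0 ≤ η p)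
    (hψT : tsupport ψ ⊆ Ioo (-T) T ×ˢ univ)
    (hηT : ∀ p ∈ tsupport ψ, ∀ r ∈ tsupport η, p - r ∈ Ioo (-T) T ×ˢ (univ : Set (E N))) :
    0 ≤ ∫ p, ∫ q, doubled f J G ψ η w v p q := by
  set K := tsupport ψ with hKdef
  set B := tsupport η with hBdef
  have hK : IsCompact K := hψc
  have hB : IsCompact B := hηc
  -- If `p ∈ K` and `p - q ∈ B` then `q ∈ K'`, so the doubled test function is supported in `K ×
  -- K'`.
  set K' : Set (ℝ × E N) := (fun z : (ℝ × E N) × (ℝ × E N) => z.1 - z.2) '' (K ×ˢ B) with hK'def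
  have hK' : IsCompact K' := (hK.prod hB).image (continuous_fst.sub continuous_snd)
  have hψd := hψ.differentiable (by simp)
  have hηd := hη.differentiable (by simp)
  have hψ'c : Continuous (fderiv ℝ ψ) := hψ.continuous_fderiv (by simp)
  have hη'c : Continuous (fderiv ℝ η) := hη.continuous_fderiv (by simp)
  obtain ⟨C1, hC1⟩ := hψ.continuous.bounded_above_of_compact_support hψc
  obtain ⟨C2, hC2⟩ := hψ'c.bounded_above_of_compact_support (hψc.fderiv (𝕜 := ℝ))
  obtain ⟨C3, hC3⟩ := hη.continuous.bounded_above_of_compact_support hηc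
  obtain ⟨C4, hC4⟩ := hη'c.bounded_above_of_compact_support (hηc.fderiv (𝕜 := ℝ))
  have hz1 : ∀ p, p ∉ K → ψ p = 0 := fun p hp => image_eq_zero_of_notMem_tsupport hp
  have hz2 : ∀ p, p ∉ K → fderiv ℝ ψ p = 0 := fun p hp =>
    image_eq_zero_of_notMem_tsupport fun h => hp (tsupport_fderiv_subset ℝ h)
  have hz3 : ∀ p, p ∉ B → η p = 0 := fun p hp => image_eq_zero_of_notMem_tsupport hp
  have hz4 : ∀ p, p ∉ B → fderiv ℝ η p = 0 := fun p hp =>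
    image_eq_zero_of_notMem_tsupport fun h => hp (tsupport_fderiv_subset ℝ h)
  -- derivatives of the test function in each of the two variables
  have hd1 : ∀ p q, fderiv ℝ (fun p' => ψ p' * η (p' - q)) p
      = ψ p • fderiv ℝ η (p - q) + η (p - q) • fderiv ℝ ψ p := fun p q => by
    have h1 : DifferentiableAt ℝ (fun p' => η (p' - q)) p :=
      (hηd _).comp p (differentiableAt_id.sub_const q)
    have h2 : fderiv ℝ (fun p' => η (p' - q)) p = fderiv ℝ η (p - q) := by
      simpa only [sub_eq_add_neg] using fderiv_comp_add_right (𝕜 := ℝ) (f := η) (x := p) (-q)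
    rw [fderiv_fun_mul (hψd p) h1, h2]
  have hd2 : ∀ p q, fderiv ℝ (fun q' => ψ p * η (p - q')) q = -(ψ p • fderiv ℝ η (p - q)) :=
    fun p q => by
    have h1 : HasFDerivAt (fun q' => p - q') (-ContinuousLinearMap.id ℝ (ℝ × E N)) q :=
      (hasFDerivAt_id q).const_sub p
    have h2 := ((hηd (p - q)).hasFDerivAt.comp q h1).const_mul (ψ p)
    rw [show (fun q' => ψ p * η (p - q')) = fun y => ψ p * (η ∘ fun q' => p - q') y from rfl,
      h2.fderiv]
    ext <;> simp
  -- `A` is the entropy integrand of `w` with constant `v q`, and `A'` that of `v` with constant `w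
  -- p`.
  let A : (ℝ × E N) → (ℝ × E N) → ℝ := fun p q =>
    fderiv ℝ (fun p' => ψ p' * η (p' - q)) p (kflux f J p (w p) (v q))
      - Real.sign (w p - v q) * source f J G p (v q) * (ψ p * η (p - q))
  let A' : (ℝ × E N) → (ℝ × E N) → ℝ := fun p q =>
    fderiv ℝ (fun q' => ψ p * η (p - q')) q (kflux f J q (v q) (w p))
      - Real.sign (v q - w p) * source f J G q (w p) * (ψ p * η (p - q))
  have hA : ∀ q, 0 ≤ ∫ p, A p q := fun q => by
    refine hwK (fun p' => ψ p' * η (p' - q)) (hψ.mul (hη.comp (contDiff_id.sub contDiff_const)))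
      hψc.mul_right ((tsupport_mul_subset_left).trans hψT)
      (fun p => mul_nonneg (hψ0 _) (hη0 _)) (v q)
  have hA' : ∀ p, 0 ≤ ∫ q, A' p q := fun p => by
    have hcs : tsupport (fun q' => ψ p * η (p - q')) ⊆ (fun r => p - r) '' B := by
      refine closure_minimal (fun q hq => ?_) (hB.image (by fun_prop)).isClosed
      refine ⟨p - q, ?_, by simp⟩
      by_contra h
      exact hq (by simp only [hz3 _ h, mul_zero])
    refine hvK (fun q' => ψ p * η (p - q')) (contDiff_const.mul
      (hη.comp (contDiff_const.sub contDiff_id)))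
      (HasCompactSupport.intro (hB.image (by fun_prop : Continuous fun r => p - r))
        fun q hq => image_eq_zero_of_notMem_tsupport
          (f := fun q' => ψ p * η (p - q')) fun h => hq (hcs h)) ?_
      (fun q => mul_nonneg (hψ0 _) (hη0 _)) (w p)
    -- The support condition on `p - r` is available only for `p ∈ K`; otherwise the test function
    -- vanishes identically.
    by_cases hp : p ∈ K
    · rintro q hq
      obtain ⟨r, hr, rfl⟩ := hcs hq
      exact hηT p hp r hr
    · have : (fun q' => ψ p * η (p - q')) = fun _ => (0 : ℝ) := by
        funext q; rw [hz1 p hp, zero_mul]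
      rw [this]
      simp [tsupport]
  -- The derivatives of `η(p - q)` in `p` and in `q` are opposite, so by symmetry of the Kruzhkov
  -- flux only its difference between `p` and `q` meets `η'`.
  have hsum : ∀ p q, doubled f J G ψ η w v p q = A p q + A' p q := fun p q => by
    simp only [doubled, A, A', hd1, hd2, kflux_comm f J q (v q) (w p), sign_sub_comm (w p) (v q)]
    simp only [add_apply, smul_apply, smul_eq_mul,
      neg_apply, map_sub]
    ring
  have hm1 : Measurable fun z : (ℝ × E N) × (ℝ × E N) => z.1 := measurable_fst
  have hm2 : Measurable fun z : (ℝ × E N) × (ℝ × E N) => z.2 := measurable_snd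
  have hmA : Measurable fun z : (ℝ × E N) × (ℝ × E N) => A z.1 z.2 := by
    simp only [A, hd1]
    have hmd : Measurable fun z : (ℝ × E N) × (ℝ × E N) =>
        ψ z.1 • fderiv ℝ η (z.1 - z.2) + η (z.1 - z.2) • fderiv ℝ ψ z.1 := by
      refine Continuous.measurable ?_
      have := hψ.continuous
      have := hη.continuous
      fun_prop
    refine (measurable_clm_apply hmd (measurable_kflux hf.continuous hJ hm1 (hw.comp hm1)
      (hv.comp hm2))).sub ((((measurable_sign.comp ((hw.comp hm1).sub (hv.comp hm2)))).mul
        (measurable_source hf hJ hG hm1 (hv.comp hm2))).mul ?_)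
    exact (hψ.continuous.measurable.comp hm1).mul (hη.continuous.measurable.comp (hm1.sub hm2))
  have hmA' : Measurable fun z : (ℝ × E N) × (ℝ × E N) => A' z.1 z.2 := by
    simp only [A', hd2]
    have hmd : Measurable fun z : (ℝ × E N) × (ℝ × E N) =>
        -(ψ z.1 • fderiv ℝ η (z.1 - z.2)) := by
      refine Continuous.measurable ?_
      have := hψ.continuous
      fun_prop
    refine (measurable_clm_apply hmd (measurable_kflux hf.continuous hJ hm2 (hv.comp hm2)
      (hw.comp hm1))).sub ((((measurable_sign.comp ((hv.comp hm2).sub (hw.comp hm1)))).mul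
        (measurable_source hf hJ hG hm2 (hw.comp hm1))).mul ?_)
    exact (hψ.continuous.measurable.comp hm1).mul (hη.continuous.measurable.comp (hm1.sub hm2))
  have hC1' : 0 ≤ C1 := (norm_nonneg _).trans (hC1 0)
  have hC2' : 0 ≤ C2 := (norm_nonneg _).trans (hC2 0)
  have hC3' : 0 ≤ C3 := (norm_nonneg _).trans (hC3 0)
  have hC4' : 0 ≤ C4 := (norm_nonneg _).trans (hC4 0)
  have hL0 : (0 : ℝ) ≤ L := L.2
  have hmemK' : ∀ p q, p ∈ K → p - q ∈ B → q ∈ K' := fun p q hp hq =>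
    ⟨(p, p - q), ⟨hp, hq⟩, by simp⟩
  set D : ℝ := (C1 * C4 + C3 * C2) * (1 + L) with hD
  have hD0 : 0 ≤ D := by positivity
  set D' : ℝ := L * (C1 * C3) with hD'
  have hgi : ∀ k : ℝ × E N → ℝ, LocallyIntegrable k →
      LocallyIntegrable (fun p => D * |k p| + D' * ‖G p‖) := fun k hk =>
    ((locallyIntegrable_norm hk).smul D).add ((locallyIntegrable_norm hGi).smul D')
  have hgi0 : ∀ k : ℝ × E N → ℝ, LocallyIntegrable k →
      LocallyIntegrable (fun p => D * |k p|) := fun k hk =>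
    (locallyIntegrable_norm hk).smul D
  have hψη : ∀ p q, |ψ p * η (p - q)| ≤ C1 * C3 := fun p q => by
    rw [abs_mul]
    exact mul_le_mul (hC1 p) (hC3 _) (abs_nonneg _) hC1'
  have hsrc : ∀ (s : ℝ) (p' p q) (a : ℝ),
      |Real.sign s * source f J G p' a * (ψ p * η (p - q))| ≤ D' * ‖G p'‖ := by
    intro s p' p q a
    rw [abs_mul, abs_mul]
    have h1 : |Real.sign s| * |source f J G p' a| ≤ L * ‖G p'‖ :=
      (mul_le_of_le_one_left (abs_nonneg _) (abs_sign_le_one _)).trans (abs_source_le hL _ _)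
    calc _ ≤ (L * ‖G p'‖) * (C1 * C3) := mul_le_mul h1 (hψη p q) (abs_nonneg _) (by positivity)
      _ = D' * ‖G p'‖ := by rw [hD']; ring
  have hIA : Integrable (fun z : (ℝ × E N) × (ℝ × E N) => A z.1 z.2) := by
    refine integrable_of_le_on_compact_prod hmA hK hK' (hgi w hwi) (hgi0 v hvi)
      (fun z hz => ?_) fun z _ => ?_
    · simp only [A, hd1]
      by_cases hp : z.1 ∈ K
      · have : z.1 - z.2 ∉ B := fun h => hz ⟨hp, hmemK' _ _ hp h⟩
        simp [hz3 _ this, hz4 _ this]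
      · simp [hz1 _ hp, hz2 _ hp]
    · simp only [A, hd1]
      have h1 : ‖ψ z.1 • fderiv ℝ η (z.1 - z.2) + η (z.1 - z.2) • fderiv ℝ ψ z.1‖
          ≤ C1 * C4 + C3 * C2 := by
        refine (norm_add_le _ _).trans (add_le_add ?_ ?_) <;> rw [norm_smul]
        · exact mul_le_mul (hC1 _) (hC4 _) (norm_nonneg _) hC1'
        · exact mul_le_mul (hC3 _) (hC2 _) (norm_nonneg _) hC3'
      have h2 := ContinuousLinearMap.le_of_opNorm_le_of_le _ h1
        (norm_kflux_le hL z.1 (w z.1) (v z.2) (J := J))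
      rw [Real.norm_eq_abs] at h2
      have h3 := hsrc (w z.1 - v z.2) z.1 z.1 z.2 (v z.2)
      refine (abs_sub _ _).trans ((add_le_add h2 h3).trans (le_of_eq ?_))
      rw [hD]; ring
  have hIA' : Integrable (fun z : (ℝ × E N) × (ℝ × E N) => A' z.1 z.2) := by
    refine integrable_of_le_on_compact_prod hmA' hK hK' (hgi0 w hwi) (hgi v hvi)
      (fun z hz => ?_) fun z _ => ?_
    · simp only [A', hd2]
      by_cases hp : z.1 ∈ K
      · have : z.1 - z.2 ∉ B := fun h => hz ⟨hp, hmemK' _ _ hp h⟩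
        simp [hz3 _ this, hz4 _ this]
      · simp [hz1 _ hp]
    · simp only [A', hd2]
      have h1 : ‖-(ψ z.1 • fderiv ℝ η (z.1 - z.2))‖ ≤ C1 * C4 + C3 * C2 := by
        rw [norm_neg, norm_smul]
        exact (mul_le_mul (hC1 _) (hC4 _) (norm_nonneg _) hC1').trans
          (le_add_of_nonneg_right (by positivity))
      have h2 := ContinuousLinearMap.le_of_opNorm_le_of_le _ h1
        (norm_kflux_le hL z.2 (v z.2) (w z.1) (J := J))
      rw [Real.norm_eq_abs] at h2
      have h3 := hsrc (v z.2 - w z.1) z.2 z.1 z.2 (w z.1)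
      refine (abs_sub _ _).trans ((add_le_add h2 h3).trans (le_of_eq ?_))
      rw [hD]; ring
  have e1 : ∫ p, ∫ q, doubled f J G ψ η w v p q
      = ∫ z : (ℝ × E N) × (ℝ × E N), (A z.1 z.2 + A' z.1 z.2) := by
    simp only [hsum]
    exact (integral_prod _ (hIA.add hIA')).symm
  rw [e1, integral_add hIA hIA']
  refine add_nonneg ?_ ?_
  · rw [show ∫ z : (ℝ × E N) × (ℝ × E N), A z.1 z.2 = ∫ q, ∫ p, A p q from
      integral_prod_symm _ hIA]
    exact integral_nonneg hA
  · rw [show ∫ z : (ℝ × E N) × (ℝ × E N), A' z.1 z.2 = ∫ p, ∫ q, A' p q from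
      integral_prod _ hIA']
    exact integral_nonneg hA'

/-! ### Choice of the mollification scales -/

/-- Bounds the variation of the data between `p` and `p - (ε τ, h z)`; the variation in time is
weighted by `h⁻¹`. -/
def discrepancy (J : ℝ × E N → ℝ) (G : ℝ × E N → E N) (w v : ℝ × E N → ℝ) (ε h : ℝ)
    (p r : ℝ × E N) : ℝ :=
  |v (p - dil N ε h r) - v p| + |J (p - dil N ε h r) - J p|
    + ‖G (p - dil N ε h r) - G p‖ + |heav (p - dil N ε h r) - heav p|
    + h⁻¹ * (|heav p - heav (p - dil N ε h r)| * (|w p| + |v (p - dil N ε h r)|)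
      + |J (p - dil N 0 h r) - J (p - dil N ε h r)|)

theorem discrepancy_nonneg {J : ℝ × E N → ℝ} {G : ℝ × E N → E N} {w v : ℝ × E N → ℝ} {ε h : ℝ}
    (hh : 0 < h) (p r : ℝ × E N) : 0 ≤ discrepancy J G w v ε h p r := by
  unfold discrepancy; positivity

theorem measurable_discrepancy {J : ℝ × E N → ℝ} {G : ℝ × E N → E N} {w v : ℝ × E N → ℝ}
    (hJ : Measurable J) (hG : Measurable G) (hw : Measurable w) (hv : Measurable v) (ε h : ℝ) :
    Measurable fun z : (ℝ × E N) × (ℝ × E N) => discrepancy J G w v ε h z.1 z.2 := by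
  have hp : Measurable fun z : (ℝ × E N) × (ℝ × E N) => z.1 := measurable_fst
  have hd : ∀ ε' : ℝ, Measurable fun z : (ℝ × E N) × (ℝ × E N) => z.1 - dil N ε' h z.2 :=
    fun ε' => hp.sub ((dil N ε' h).continuous.measurable.comp measurable_snd)
  have hq := hd ε
  unfold discrepancy
  refine (((((hv.comp hq).sub (hv.comp hp)).abs.add ((hJ.comp hq).sub (hJ.comp hp)).abs).add
    ((hG.comp hq).sub (hG.comp hp)).norm).add
      ((measurable_heav.comp hq).sub (measurable_heav.comp hp)).abs).add
      (measurable_const.mul (((((measurable_heav.comp hp).sub (measurable_heav.comp hq)).abs).mul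
        ((hw.comp hp).abs.add (hv.comp hq).abs)).add
          ((hJ.comp (hd 0)).sub (hJ.comp hq)).abs))

theorem locallyIntegrable_heav_mul {w : ℝ × E N → ℝ} (hw : LocallyIntegrable w) :
    LocallyIntegrable fun p => heav p * w p := by
  refine hw.mono ((measurable_heav.aestronglyMeasurable).mul hw.aestronglyMeasurable) ?_
  refine Eventually.of_forall fun p => ?_
  rw [norm_mul]
  exact mul_le_of_le_one_left (norm_nonneg _) (abs_heav_le_one p)

theorem locallyIntegrable_heav : LocallyIntegrable (heav : ℝ × E N → ℝ) :=
  (locallyIntegrable_const (1 : ℝ)).mono measurable_heav.aestronglyMeasurable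
    (Eventually.of_forall fun p => by simpa using abs_heav_le_one p)

/-- Translation continuity does not directly control a jump of a bounded function multiplied by an
L¹ function. The bound passes to increments of the product `s a` and of `a` itself, both locally
integrable in the application. -/
theorem abs_sub_mul_abs_le {s s' a a' : ℝ} (hs' : |s'| ≤ 1) :
    |s - s'| * |a| ≤ |s' * a' - s * a| + |a' - a| := by
  rw [← abs_mul]
  calc |(s - s') * a| = |-(s' * a' - s * a) + s' * (a' - a)| := by congr 1; ring
    _ ≤ |-(s' * a' - s * a)| + |s' * (a' - a)| := abs_add_le _ _
    _ ≤ _ := by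
      rw [abs_neg, abs_mul s']
      gcongr
      exact mul_le_of_le_one_left (abs_nonneg _) hs'

/-- The scales are chosen in succession. Translation continuity in space-time fixes `h`; then pure
time translations are made small compared with `h`, which fixes `ε` and pays for the factor `h⁻¹`.
-/
theorem exists_scales_discrepancy_le {J : ℝ × E N → ℝ} {G : ℝ × E N → E N} {w v : ℝ × E N → ℝ}
    (hJ : Measurable J) (hJi : LocallyIntegrable J) (hG : Measurable G)
    (hGi : LocallyIntegrable G) (hw : Measurable w) (hwi : LocallyIntegrable w)
    (hv : Measurable v) (hvi : LocallyIntegrable v) {K : Set (ℝ × E N)} (hK : IsCompact K)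
    {δ : ℝ} (hδ : 0 < δ) :
    ∃ ε h : ℝ, 0 < ε ∧ ε ≤ h ∧ h ≤ δ ∧
      ∫⁻ z, ENNReal.ofReal (discrepancy J G w v ε h z.1 z.2)
        ∂((volume.restrict K).prod (volume.restrict (Metric.closedBall (0 : ℝ × E N) 1)))
        ≤ ENNReal.ofReal δ := by
  set B := Metric.closedBall (0 : ℝ × E N) 1
  have hBfin : volume B ≠ ∞ := (isCompact_closedBall _ _).measure_lt_top.ne
  -- For each `r ∈ B` the plain and the `h⁻¹`-weighted increments contribute at most `c` each, and
  -- `2c · vol(B) ≤ δ`; the `+ 1` avoids dividing by zero.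
  set c : ℝ := δ / (2 * ((volume B).toReal + 1)) with hc
  have hvB : 0 ≤ (volume B).toReal := ENNReal.toReal_nonneg
  have hc0 : 0 < c := by positivity
  set K2 := Metric.cthickening 1 K
  have hK2 : IsCompact K2 := hK.cthickening
  -- the modulus of continuity in space-time
  have t1 := (((tendsto_setLIntegral_enorm_translate_sub hvi hK).add
    (tendsto_setLIntegral_enorm_translate_sub hJi hK)).add
    (tendsto_setLIntegral_enorm_translate_sub hGi hK)).add
    (tendsto_setLIntegral_enorm_translate_sub (locallyIntegrable_heav (N := N)) hK)
  have t2 := ((((tendsto_setLIntegral_enorm_translate_sub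
    (locallyIntegrable_heav_mul hwi) hK2).add
    (tendsto_setLIntegral_enorm_translate_sub hwi hK2)).add
    (tendsto_setLIntegral_enorm_translate_sub (locallyIntegrable_heav_mul hvi) hK2)).add
    (tendsto_setLIntegral_enorm_translate_sub hvi hK2)).add
    (tendsto_setLIntegral_enorm_translate_sub hJi hK2)
  simp only [add_zero] at t1 t2
  have e1 := Metric.eventually_nhds_iff_ball.1
    (t1.eventually (gt_mem_nhds (ENNReal.ofReal_pos.2 hc0)))
  obtain ⟨δ1, hδ1, H1⟩ := e1
  set h : ℝ := min δ (min 1 (δ1 / 2)) with hh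
  have hh0 : 0 < h := by positivity
  have hhδ : h ≤ δ := min_le_left _ _
  have hh1 : h ≤ 1 := (min_le_right _ _).trans (min_le_left _ _)
  have hhδ1 : h ≤ δ1 / 2 := (min_le_right _ _).trans (min_le_right _ _)
  have e2 := Metric.eventually_nhds_iff_ball.1
    -- The threshold is `h c` rather than `c`, so that multiplication by `h⁻¹` leaves `c`.
    (t2.eventually (gt_mem_nhds (ENNReal.ofReal_pos.2 (mul_pos hh0 hc0))))
  obtain ⟨δ2, hδ2, H2⟩ := e2
  set ε : ℝ := min h (δ2 / 2) with hε
  have hε0 : 0 < ε := by positivity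
  have hεh : ε ≤ h := min_le_left _ _
  have hεδ2 : ε ≤ δ2 / 2 := min_le_right _ _
  refine ⟨ε, h, hε0, hεh, hhδ, ?_⟩
  have hmeas := (measurable_discrepancy hJ hG hw hv ε h).ennreal_ofReal
  rw [lintegral_prod_symm' _ hmeas]
  have hinner : ∀ r ∈ B, ∫⁻ p in K, ENNReal.ofReal (discrepancy J G w v ε h p r)
      ≤ ENNReal.ofReal (2 * c) := by
    intro r hr
    have hr1 : ‖r‖ ≤ 1 := by simpa [B] using hr
    set y := dil N ε h r with hy
    set y0 := dil N 0 h r with hy0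
    set y1 : ℝ × E N := (ε * r.1, 0) with hy1
    -- The shift splits into a spatial shift `y0`, which `heav` does not see, and a temporal shift
    -- `y1` of length at most `ε`.
    have hyy : y = y0 + y1 := by ext <;> simp [hy, hy0, hy1]
    have hyn : ‖y‖ < δ1 := by
      have := norm_dil_le hε0.le hεh r
      nlinarith [norm_nonneg r]
    have hy0n : ‖y0‖ ≤ 1 := by
      have := norm_dil_le le_rfl hh0.le r
      nlinarith [norm_nonneg r]
    have hy1n : ‖y1‖ < δ2 := by
      have : ‖y1‖ ≤ ε * 1 := by
        rw [hy1, Prod.norm_def]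
        refine max_le ?_ (by simpa using hε0.le)
        rw [norm_mul, Real.norm_of_nonneg hε0.le]
        exact mul_le_mul_of_nonneg_left ((norm_fst_le r).trans hr1) hε0.le
      linarith
    have F1 := H1 y (by simpa using hyn)
    have F2 := H2 y1 (by simpa using hy1n)
    -- pointwise bound by increments
    have hpt : ∀ p, ENNReal.ofReal (discrepancy J G w v ε h p r) ≤
        (‖v (p - y) - v p‖ₑ + ‖J (p - y) - J p‖ₑ + ‖G (p - y) - G p‖ₑ
          + ‖heav (p - y) - heav p‖ₑ)
        + ENNReal.ofReal h⁻¹ * ((‖heav (p - y1) * w (p - y1) - heav p * w p‖ₑ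
            + ‖w (p - y1) - w p‖ₑ)
          + (‖heav (p - y0 - y1) * v (p - y0 - y1) - heav (p - y0) * v (p - y0)‖ₑ
            + ‖v (p - y0 - y1) - v (p - y0)‖ₑ
            + ‖J (p - y0 - y1) - J (p - y0)‖ₑ)) := by
      intro p
      have hpy : p - y = p - y0 - y1 := by rw [hyy]; abel
      have hh1' : heav (p - y) = heav (p - y1) := by simp [heav, hy, hy1]
      have hh2' : heav p = heav (p - y0) := by simp [heav, hy0]
      have b1 : |heav p - heav (p - y)| * |w p| ≤
          |heav (p - y1) * w (p - y1) - heav p * w p| + |w (p - y1) - w p| := by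
        rw [hh1']; exact abs_sub_mul_abs_le (abs_heav_le_one _)
      have b2 : |heav p - heav (p - y)| * |v (p - y)| ≤
          |heav (p - y0 - y1) * v (p - y0 - y1) - heav (p - y0) * v (p - y0)|
            + |v (p - y0 - y1) - v (p - y0)| := by
        rw [hh2', ← hpy, abs_sub_comm (heav (p - y0)), abs_sub_comm (heav (p - y) * _),
          abs_sub_comm (v (p - y))]
        exact abs_sub_mul_abs_le (abs_heav_le_one _)
      have b3 : discrepancy J G w v ε h p r ≤
          (|v (p - y) - v p| + |J (p - y) - J p| + ‖G (p - y) - G p‖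
            + |heav (p - y) - heav p|)
          + h⁻¹ * ((|heav (p - y1) * w (p - y1) - heav p * w p| + |w (p - y1) - w p|)
            + (|heav (p - y0 - y1) * v (p - y0 - y1) - heav (p - y0) * v (p - y0)|
            + |v (p - y0 - y1) - v (p - y0)| + |J (p - y0 - y1) - J (p - y0)|)) := by
        unfold discrepancy
        rw [← hy, ← hy0]
        refine add_le_add le_rfl (mul_le_mul_of_nonneg_left ?_ (by positivity))
        rw [mul_add, ← hpy, abs_sub_comm (J (p - y0)), ← add_assoc]
        rw [← hpy] at b2
        linarith
      refine (ENNReal.ofReal_le_ofReal b3).trans (le_of_eq ?_)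
      simp only [← ofReal_norm, Real.norm_eq_abs]
      rw [ENNReal.ofReal_add (by positivity) (by positivity),
        ENNReal.ofReal_mul (by positivity)]
      repeat rw [ENNReal.ofReal_add (by positivity) (by positivity)]
    have hsub : ∀ y : ℝ × E N, Measurable fun p : ℝ × E N => p - y := fun y =>
      measurable_id.sub_const y
    have meas : ∀ {H : Type} [NormedAddCommGroup H] [MeasurableSpace H] [BorelSpace H]
        [SecondCountableTopology H]
        {F : ℝ × E N → H} (y : ℝ × E N), Measurable F →
        Measurable fun p => ‖F (p - y) - F p‖ₑ := fun y hF =>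
      ((hF.comp (hsub y)).sub hF).enorm
    have madd : ∀ {a b : ℝ × E N → ℝ≥0∞}, Measurable a → Measurable b →
        Measurable fun p => a p + b p := fun ha hb => ha.add hb
    have mχw : Measurable fun p : ℝ × E N => heav p * w p := measurable_heav.mul hw
    have mχv : Measurable fun p : ℝ × E N => heav p * v p := measurable_heav.mul hv
    -- Translating by the spatial shift reduces to pure time increments on the enlarged set `K2`,
    -- independently of `h`.
    have hshift : ∫⁻ p in K, (‖heav (p - y0 - y1) * v (p - y0 - y1)
          - heav (p - y0) * v (p - y0)‖ₑ
            + ‖v (p - y0 - y1) - v (p - y0)‖ₑ + ‖J (p - y0 - y1) - J (p - y0)‖ₑ)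
        ≤ ∫⁻ p in K2, (‖heav (p - y1) * v (p - y1) - heav p * v p‖ₑ
            + ‖v (p - y1) - v p‖ₑ + ‖J (p - y1) - J p‖ₑ) := by
      set g : ℝ × E N → ℝ≥0∞ := fun p => ‖heav (p - y1) * v (p - y1) - heav p * v p‖ₑ
            + ‖v (p - y1) - v p‖ₑ + ‖J (p - y1) - J p‖ₑ
      have : ∫⁻ p in K2, g p = ∫⁻ p, K2.indicator g p :=
        (lintegral_indicator hK2.measurableSet g).symm
      rw [this, ← lintegral_sub_right_eq_self (K2.indicator g) y0]
      refine le_trans (le_of_eq ?_) (setLIntegral_le_lintegral K _)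
      refine setLIntegral_congr_fun hK.measurableSet fun p hp => ?_
      have : p - y0 ∈ K2 :=
        Metric.mem_cthickening_of_dist_le _ p _ _ hp (by simpa [dist_eq_norm] using hy0n)
      simp only [indicator_of_mem this, g]
    have hKK2 : K ⊆ K2 := Metric.self_subset_cthickening K
    calc ∫⁻ p in K, ENNReal.ofReal (discrepancy J G w v ε h p r)
        ≤ ∫⁻ p in K, ((‖v (p - y) - v p‖ₑ + ‖J (p - y) - J p‖ₑ + ‖G (p - y) - G p‖ₑ
          + ‖heav (p - y) - heav p‖ₑ)
        + ENNReal.ofReal h⁻¹ * ((‖heav (p - y1) * w (p - y1) - heav p * w p‖ₑ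
            + ‖w (p - y1) - w p‖ₑ)
          + (‖heav (p - y0 - y1) * v (p - y0 - y1) - heav (p - y0) * v (p - y0)‖ₑ
            + ‖v (p - y0 - y1) - v (p - y0)‖ₑ
            + ‖J (p - y0 - y1) - J (p - y0)‖ₑ))) := lintegral_mono hpt
      _ = (∫⁻ p in K, (‖v (p - y) - v p‖ₑ + ‖J (p - y) - J p‖ₑ + ‖G (p - y) - G p‖ₑ
          + ‖heav (p - y) - heav p‖ₑ))
        + ENNReal.ofReal h⁻¹ * ((∫⁻ p in K, (‖heav (p - y1) * w (p - y1) - heav p * w p‖ₑ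
            + ‖w (p - y1) - w p‖ₑ))
          + ∫⁻ p in K, (‖heav (p - y0 - y1) * v (p - y0 - y1) - heav (p - y0) * v (p - y0)‖ₑ
            + ‖v (p - y0 - y1) - v (p - y0)‖ₑ
            + ‖J (p - y0 - y1) - J (p - y0)‖ₑ)) := by
        rw [lintegral_add_left (madd (madd (madd (meas y hv) (meas y hJ)) (meas y hG))
          (meas y measurable_heav)), lintegral_const_mul', lintegral_add_left
            (madd (meas y1 mχw) (meas y1 hw))]
        exact ENNReal.ofReal_ne_top
      _ ≤ ENNReal.ofReal c + ENNReal.ofReal h⁻¹ * ENNReal.ofReal (h * c) := by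
        refine add_le_add ?_ (mul_le_mul_right ?_ _)
        · rw [lintegral_add_left (madd (madd (meas y hv) (meas y hJ)) (meas y hG)),
            lintegral_add_left (madd (meas y hv) (meas y hJ)), lintegral_add_left (meas y hv)]
          exact F1.le
        · refine le_trans (add_le_add (lintegral_mono_set hKK2) hshift) ?_
          rw [lintegral_add_left (meas y1 mχw),
            lintegral_add_left (madd (meas y1 mχv) (meas y1 hv)),
            lintegral_add_left (meas y1 mχv), ← add_assoc, ← add_assoc]
          exact F2.le
      _ = ENNReal.ofReal (2 * c) := by
        rw [← ENNReal.ofReal_mul (by positivity), ← ENNReal.ofReal_add hc0.le (by positivity)]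
        congr 1
        field_simp
        ring
  calc _ ≤ ∫⁻ _ in B, ENNReal.ofReal (2 * c) :=
        setLIntegral_mono' (Metric.isClosed_closedBall.measurableSet) hinner
    _ = ENNReal.ofReal (2 * c) * volume B := setLIntegral_const _ _
    _ = ENNReal.ofReal (2 * c * (volume B).toReal) := by
      rw [ENNReal.ofReal_mul (p := 2 * c) (by positivity), ENNReal.ofReal_toReal hBfin]
    _ ≤ ENNReal.ofReal δ := by
      refine ENNReal.ofReal_le_ofReal ?_
      rw [hc]
      have : 2 * (δ / (2 * ((volume B).toReal + 1))) * (volume B).toReal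
          = δ * ((volume B).toReal / ((volume B).toReal + 1)) := by field_simp
      rw [this]
      exact mul_le_of_le_one_right hδ.le ((div_le_one (by positivity)).2 (by linarith))

/-! ### The Kato inequality -/

/-- A measurable function `J` on space-time with spatial gradient `G` at almost every time, the
Lipschitz constants being locally integrable in time. -/
structure HasSpatialGradient (J : ℝ × E N → ℝ) (G : ℝ × E N → E N) (m : ℝ → ℝ) : Prop where
  measurable : Measurable J
  locallyIntegrable : LocallyIntegrable J
  measurable_grad : Measurable G
  locallyIntegrable_grad : LocallyIntegrable G
  locallyIntegrable_bound : LocallyIntegrable fun p : ℝ × E N => m p.1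
  hasGradientAt : ∀ᵐ t : ℝ, ∀ x, HasGradientAt (fun y => J (t, y)) (G (t, x)) x
  norm_grad_le : ∀ᵐ t : ℝ, ∀ x, ‖G (t, x)‖ ≤ m t

theorem HasSpatialGradient.abs_sub_le {J : ℝ × E N → ℝ} {G : ℝ × E N → E N} {m : ℝ → ℝ}
    (h : HasSpatialGradient J G m) :
    ∀ᵐ t : ℝ, ∀ x y, |J (t, x) - J (t, y)| ≤ m t * ‖x - y‖ := by
  filter_upwards [h.hasGradientAt, h.norm_grad_le] with t h1 h2 x y
  have := convex_univ.norm_image_sub_le_of_norm_hasFDerivWithin_le (𝕜 := ℝ)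
    (f := fun y => J (t, y)) (C := m t)
    (fun z _ => (h1 z).hasFDerivAt.hasFDerivWithinAt) (fun z _ => by simpa using h2 z)
    (mem_univ y) (mem_univ x)
  simpa using this

/-- The base point `a n` moves with `n`, so differentiability at a point is not enough; the strict
derivative of a C¹ function is used, and the remainder is `o(h)` because the increments are `O(h)`.
-/
theorem tendsto_inv_smul_increment {F : Type*} [NormedAddCommGroup F] [NormedSpace ℝ F]
    {f : ℝ → F} (hf : ContDiff ℝ 1 f) {a h j : ℕ → ℝ} {a₀ j₀ g : ℝ}
    (ha : Tendsto a atTop (𝓝 a₀)) (hj : Tendsto j atTop (𝓝 j₀))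
    (hg : Tendsto (fun n => (h n)⁻¹ * (j₀ - j n)) atTop (𝓝 g)) (hh : ∀ n, h n ≠ 0) :
    Tendsto (fun n => (h n)⁻¹ • (f (a n + j₀) - f (a n + j n))) atTop
      (𝓝 (g • deriv f (a₀ + j₀))) := by
  have hs := (hf.contDiffAt.hasStrictDerivAt (x := a₀ + j₀) one_ne_zero).hasStrictFDerivAt
  have hpair : Tendsto (fun n => (a n + j₀, a n + j n)) atTop (𝓝 (a₀ + j₀, a₀ + j₀)) :=
    (ha.add tendsto_const_nhds).prodMk_nhds (ha.add hj)
  have ho := hs.isLittleO.comp_tendsto hpair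
  have hO : (fun n => (a n + j₀) - (a n + j n)) =O[atTop] h := by
    have h1 : (fun n => (h n)⁻¹ * (j₀ - j n)) =O[atTop] (fun _ => (1 : ℝ)) := hg.isBigO_one ℝ
    have h2 := (Asymptotics.isBigO_refl h atTop).mul h1
    refine (h2.congr_left fun n => ?_).congr_right fun n => mul_one _
    field_simp [hh n]
    ring
  have h0 := (ho.trans_isBigO hO).tendsto_inv_smul_nhds_zero
  have h3 := h0.add (hg.smul_const (deriv f (a₀ + j₀)))
  rw [zero_add] at h3
  refine h3.congr fun n => ?_
  simp only [Function.comp_apply, ContinuousLinearMap.toSpanSingleton_apply]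
  rw [show a n + j₀ - (a n + j n) = j₀ - j n by ring, smul_sub, ← smul_assoc, smul_eq_mul,
    sub_add_cancel]

/-- The doubled integrand in the variables `p` and `r = ((t - s)/ε, (x - y)/h)`. -/
def scaledDoubled (f : ℝ → E N) (J : ℝ × E N → ℝ) (G : ℝ × E N → E N) (ψ κ : ℝ × E N → ℝ)
    (w v : ℝ × E N → ℝ) (ε h : ℝ) (p r : ℝ × E N) : ℝ :=
  κ r * fderiv ℝ ψ p (kflux f J p (w p) (v (p - dil N ε h r)))
    + ψ p * fderiv ℝ κ r (0, Real.sign (w p - v (p - dil N ε h r)) •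
      (h⁻¹ • ((flux f J p (w p) - flux f J p (v (p - dil N ε h r)))
        - (flux f J (p - dil N ε h r) (w p)
          - flux f J (p - dil N ε h r) (v (p - dil N ε h r))))))
    - Real.sign (w p - v (p - dil N ε h r)) • (source f J G p (v (p - dil N ε h r))
      - source f J G (p - dil N ε h r) (w p)) * (ψ p * κ r)

/-- The entropy fluxes at `p` and at `q` have the same time component `|w p - v q|`, so it drops out
of their difference. Hence `ε⁻¹` never appears and only `h⁻¹` multiplies the flux increment. -/
theorem doubled_dil_eq {f : ℝ → E N} {J : ℝ × E N → ℝ} {G : ℝ × E N → E N}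
    {ψ κ w v : ℝ × E N → ℝ} (hκ : Differentiable ℝ κ) {ε h : ℝ} (hε : 0 < ε) (hh : 0 < h)
    (p r : ℝ × E N) :
    doubled f J G ψ (fun y => κ (dil N ε⁻¹ h⁻¹ y)) w v p (p - dil N ε h r)
      = scaledDoubled f J G ψ κ w v ε h p r := by
  have hd : fderiv ℝ (fun y => κ (dil N ε⁻¹ h⁻¹ y)) (dil N ε h r)
      = (fderiv ℝ κ r).comp (dil N ε⁻¹ h⁻¹) := by
    have h1 := (hκ (dil N ε⁻¹ h⁻¹ (dil N ε h r))).hasFDerivAt.comp (dil N ε h r)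
      (dil N ε⁻¹ h⁻¹).hasFDerivAt
    rw [dil_inv_dil hε.ne' hh.ne'] at h1
    exact h1.fderiv
  unfold doubled scaledDoubled
  rw [sub_sub_cancel, hd, smul_eq_mul]
  simp only [dil_inv_dil hε.ne' hh.ne']
  congr 3
  simp only [kflux, ContinuousLinearMap.comp_apply, Prod.mk_sub_mk, sub_self, ← smul_sub,
    dil_apply, mul_zero]
  rw [smul_comm]

/-! ### Uniform bounds for the rescaled integrand -/

section Bounds

variable {f : ℝ → E N} {L : ℝ≥0} {J : ℝ × E N → ℝ} {G : ℝ × E N → E N} {ψ κ w v : ℝ × E N → ℝ}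

theorem norm_flux_sub_flux_dil_le (hL : LipschitzWith L f) (p r : ℝ × E N) (h a : ℝ) :
    ‖flux f J p a - flux f J (p - dil N 0 h r) a‖ ≤ L * |J p - J (p - dil N 0 h r)| := by
  have hh2 : heav (p - dil N 0 h r) = heav p := by simp [heav]
  unfold flux
  rw [hh2, ← smul_sub, norm_smul]
  refine (mul_le_of_le_one_left (norm_nonneg _) (abs_heav_le_one p)).trans ?_
  simpa [Real.norm_eq_abs] using hL.norm_sub_le (a + J p) (a + J (p - dil N 0 h r))

/-- If both points have nonnegative time only `J` changes, and each of the two differences costs `L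
|J p - J q|`. If exactly one does, a single difference survives, at most `L |a - b|`. If neither
does, everything vanishes. -/
theorem norm_flux_time_increment_le (hL : LipschitzWith L f) (p q : ℝ × E N) (a b : ℝ) :
    ‖(flux f J p a - flux f J p b) - (flux f J q a - flux f J q b)‖
      ≤ 2 * L * (|heav p - heav q| * (|a| + |b|) + |J p - J q|) := by
  have hab : |a - b| ≤ |a| + |b| := abs_sub a b
  have hL0 : (0 : ℝ) ≤ L := L.2
  have hJ0 := abs_nonneg (J p - J q)
  have ha0 := abs_nonneg (a - b)
  have hlip : ∀ x y : ℝ, ‖f x - f y‖ ≤ L * |x - y| := fun x y => by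
    simpa [Real.norm_eq_abs] using hL.norm_sub_le x y
  unfold flux heav
  split_ifs
  · simp only [one_smul, sub_self, abs_zero, zero_mul, zero_add]
    have h1 : f (a + J p) - f (b + J p) - (f (a + J q) - f (b + J q))
        = (f (a + J p) - f (a + J q)) - (f (b + J p) - f (b + J q)) := by abel
    rw [h1]
    have h2 := hlip (a + J p) (a + J q)
    have h3 := hlip (b + J p) (b + J q)
    rw [add_sub_add_left_eq_sub] at h2 h3
    linarith [norm_sub_le (f (a + J p) - f (a + J q)) (f (b + J p) - f (b + J q))]
  · simp only [one_smul, zero_smul, sub_zero, abs_one, one_mul]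
    have h2 := hlip (a + J p) (b + J p)
    rw [add_sub_add_right_eq_sub] at h2
    nlinarith
  · simp only [one_smul, zero_smul, zero_sub, abs_neg, abs_one, one_mul, sub_zero, norm_neg]
    have h2 := hlip (a + J q) (b + J q)
    rw [add_sub_add_right_eq_sub] at h2
    nlinarith
  · simp only [zero_smul, sub_zero, norm_zero]
    positivity

/-- The space-time flux increment, split into a spatial and a temporal part. -/
theorem norm_inv_smul_flux_increment_le (hL : LipschitzWith L f) {ε h : ℝ} (hh : 0 < h)
    {p r : ℝ × E N} (hr : ‖r‖ ≤ 1) {M : ℝ} (hM : 0 ≤ M)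
    (hJM : |J p - J (p - dil N 0 h r)| ≤ M * ‖h • r.2‖) :
    ‖h⁻¹ • ((flux f J p (w p) - flux f J p (v (p - dil N ε h r)))
        - (flux f J (p - dil N ε h r) (w p)
          - flux f J (p - dil N ε h r) (v (p - dil N ε h r))))‖
      ≤ 2 * L * (M + discrepancy J G w v ε h p r) := by
  set q := p - dil N ε h r with hq
  set s := p - dil N 0 h r with hs
  have hL0 : (0 : ℝ) ≤ L := L.2
  have hhs : heav s = heav p := by simp [heav, hs]
  -- The intermediate point `s` has the time of `p` and the position of `q`: from `p` to `s` the
  -- spatial Lipschitz bound of `J` compensates `h⁻¹`, and from `s` to `q` the weighted part of the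
  -- discrepancy does.
  have hsplit : (flux f J p (w p) - flux f J p (v q)) - (flux f J q (w p) - flux f J q (v q))
      = (flux f J p (w p) - flux f J s (w p)) - (flux f J p (v q) - flux f J s (v q))
        + ((flux f J s (w p) - flux f J s (v q)) - (flux f J q (w p) - flux f J q (v q))) := by
    abel
  have hJM' : |J p - J s| ≤ M * h := by
    refine hJM.trans (mul_le_mul_of_nonneg_left ?_ hM)
    rw [norm_smul, Real.norm_of_nonneg hh.le]
    exact mul_le_of_le_one_right hh.le ((norm_snd_le r).trans hr)
  have b1 := (norm_flux_sub_flux_dil_le (J := J) hL p r h (w p)).trans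
    (mul_le_mul_of_nonneg_left hJM' hL0)
  have b2 := (norm_flux_sub_flux_dil_le (J := J) hL p r h (v q)).trans
    (mul_le_mul_of_nonneg_left hJM' hL0)
  have b3 := norm_flux_time_increment_le (J := J) hL s q (w p) (v q)
  rw [hhs] at b3
  have b4 : h⁻¹ * (|heav p - heav q| * (|w p| + |v q|) + |J s - J q|)
      ≤ discrepancy J G w v ε h p r := by
    unfold discrepancy
    rw [← hq, ← hs]
    exact le_add_of_nonneg_left (by positivity)
  rw [hsplit, norm_smul, Real.norm_of_nonneg (inv_nonneg.2 hh.le)]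
  calc _ ≤ h⁻¹ * (L * (M * h) + L * (M * h)
        + 2 * L * (|heav p - heav q| * (|w p| + |v q|) + |J s - J q|)) := by
        refine mul_le_mul_of_nonneg_left ?_ (inv_nonneg.2 hh.le)
        exact (norm_add_le _ _).trans (add_le_add ((norm_sub_le _ _).trans (add_le_add b1 b2)) b3)
    _ = 2 * L * (M + h⁻¹ * (|heav p - heav q| * (|w p| + |v q|) + |J s - J q|)) := by
        field_simp; ring
    _ ≤ _ := by gcongr

/-- Supplies the dominating function: `Y` is meant to be the majorant, common to all scales, of a
sequence of discrepancies summable in L¹, so the right side does not depend on `ε` or `h`. -/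
theorem abs_scaledDoubled_le (hL : LipschitzWith L f) {C1 C2 C3 C4 : ℝ}
    (hC1 : ∀ p, ‖ψ p‖ ≤ C1) (hC2 : ∀ p, ‖fderiv ℝ ψ p‖ ≤ C2) (hC3 : ∀ p, ‖κ p‖ ≤ C3)
    (hC4 : ∀ p, ‖fderiv ℝ κ p‖ ≤ C4) {ε h : ℝ} (hh : 0 < h)
    {p r : ℝ × E N} (hr : ‖r‖ ≤ 1) {M Y : ℝ} (hM : 0 ≤ M)
    (hJM : |J p - J (p - dil N 0 h r)| ≤ M * ‖h • r.2‖)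
    (hY : discrepancy J G w v ε h p r ≤ Y) :
    |scaledDoubled f J G ψ κ w v ε h p r| ≤
      C3 * (C2 * ((1 + L) * (|w p| + (|v p| + Y)))) + C1 * (C4 * (2 * L * (M + Y)))
        + (L * ‖G p‖ + L * (‖G p‖ + Y)) * (C1 * C3) := by
  have hflux := (norm_inv_smul_flux_increment_le (f := f) (G := G) (w := w) (v := v) (ε := ε) hL
    hh hr hM hJM)
  have hL0 : (0 : ℝ) ≤ L := L.2
  have hC1' : 0 ≤ C1 := (norm_nonneg _).trans (hC1 0)
  have hC2' : 0 ≤ C2 := (norm_nonneg _).trans (hC2 0)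
  have hC3' : 0 ≤ C3 := (norm_nonneg _).trans (hC3 0)
  have hC4' : 0 ≤ C4 := (norm_nonneg _).trans (hC4 0)
  have hv : |v (p - dil N ε h r)| ≤ |v p| + Y := by
    have : |v (p - dil N ε h r) - v p| ≤ Y := by
      refine le_trans ?_ hY
      unfold discrepancy
      rw [add_assoc, add_assoc, add_assoc]
      exact le_add_of_nonneg_right (by positivity)
    linarith [abs_sub_abs_le_abs_sub (v (p - dil N ε h r)) (v p)]
  have hG : ‖G (p - dil N ε h r)‖ ≤ ‖G p‖ + Y := by
    have : ‖G (p - dil N ε h r) - G p‖ ≤ Y := by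
      refine le_trans ?_ hY
      unfold discrepancy
      rw [add_assoc, add_comm _ ‖_‖, add_assoc]
      exact le_add_of_nonneg_right (by positivity)
    linarith [norm_sub_norm_le (G (p - dil N ε h r)) (G p)]
  set q := p - dil N ε h r with hq
  unfold scaledDoubled
  rw [← hq]
  refine (abs_sub _ _).trans (add_le_add ((abs_add_le _ _).trans (add_le_add ?_ ?_)) ?_)
  · rw [abs_mul]
    refine mul_le_mul (hC3 r) ?_ (abs_nonneg _) hC3'
    refine ContinuousLinearMap.le_of_opNorm_le_of_le _ (hC2 p)
      ((norm_kflux_le hL p (w p) (v q)).trans ?_)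
    gcongr
  · rw [abs_mul]
    refine mul_le_mul (hC1 p) ?_ (abs_nonneg _) hC1'
    refine ContinuousLinearMap.le_of_opNorm_le_of_le _ (hC4 r) ?_
    rw [Prod.norm_def]
    refine max_le ?_ ?_
    · have h0 : 0 ≤ Y := (discrepancy_nonneg hh p r).trans hY
      rw [norm_zero]
      positivity
    rw [norm_smul, Real.norm_eq_abs]
    refine (mul_le_of_le_one_left (norm_nonneg _) (abs_sign_le_one _)).trans (hflux.trans ?_)
    gcongr
  · rw [abs_mul, smul_eq_mul, abs_mul, abs_mul (ψ p)]
    refine mul_le_mul ?_ (mul_le_mul (hC1 p) (hC3 r) (abs_nonneg _) hC1')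
      (mul_nonneg (abs_nonneg _) (abs_nonneg _)) ?_
    · refine (mul_le_of_le_one_left (abs_nonneg _) (abs_sign_le_one _)).trans
        ((abs_sub _ _).trans (add_le_add (abs_source_le hL _ _) ((abs_source_le hL _ _).trans ?_)))
      gcongr
    · have := norm_nonneg (G (p - dil N ε h r))
      exact add_nonneg (by positivity) (mul_nonneg hL0 (this.trans hG))

end Bounds

/-- The limit of the scaled doubled integrand. -/
def limitDoubled (f : ℝ → E N) (J : ℝ × E N → ℝ) (G : ℝ × E N → E N) (ψ κ : ℝ × E N → ℝ)
    (w v : ℝ × E N → ℝ) (p r : ℝ × E N) : ℝ :=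
  κ r * fderiv ℝ ψ p (kflux f J p (w p) (v p))
    + ψ p * fderiv ℝ κ r (0, Real.sign (w p - v p) •
      (heav p • (inner ℝ (G p) r.2 • deriv f (w p + J p)
        - inner ℝ (G p) r.2 • deriv f (v p + J p))))
    - Real.sign (w p - v p) • (source f J G p (v p) - source f J G p (w p)) * (ψ p * κ r)

/-- A vanishing discrepancy forces `v`, `J`, `G` and `heav` at the shifted point to converge to
their values at `p`. The discontinuity of the sign is harmless because every factor it multiplies
vanishes in the limit when `w p = v p`. -/
theorem tendsto_scaledDoubled {f : ℝ → E N} (hf : ContDiff ℝ 1 f) {L : ℝ≥0}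
    (hL : LipschitzWith L f) {J : ℝ × E N → ℝ}
    {G : ℝ × E N → E N} {ψ κ w v : ℝ × E N → ℝ} {ε h : ℕ → ℝ} (hh0 : ∀ n, 0 < h n)
    (hh : Tendsto h atTop (𝓝 0)) {p r : ℝ × E N}
    (hgrad : HasGradientAt (fun y => J (p.1, y)) (G p) p.2)
    (hX : Tendsto (fun n => discrepancy J G w v (ε n) (h n) p r) atTop (𝓝 0)) :
    Tendsto (fun n => scaledDoubled f J G ψ κ w v (ε n) (h n) p r) atTop
      (𝓝 (limitDoubled f J G ψ κ w v p r)) := by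
  set q : ℕ → ℝ × E N := fun n => p - dil N (ε n) (h n) r with hq
  set s : ℕ → ℝ × E N := fun n => p - dil N 0 (h n) r with hs
  have hf' := hf.continuous_deriv le_rfl
  -- convergence of the data
  have squeeze : ∀ {H : Type} [NormedAddCommGroup H] (F : ℝ × E N → H),
      (∀ n, ‖F (q n) - F p‖ ≤ discrepancy J G w v (ε n) (h n) p r) →
      Tendsto (fun n => F (q n)) atTop (𝓝 (F p)) := fun F hF =>
    tendsto_iff_norm_sub_tendsto_zero.2 (squeeze_zero (fun n => norm_nonneg _) hF hX)
  have hpos : ∀ n, 0 ≤ h n := fun n => (hh0 n).le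
  have cv : Tendsto (fun n => v (q n)) atTop (𝓝 (v p)) := squeeze v fun n => by
    have := hpos n
    unfold discrepancy
    rw [add_assoc, add_assoc, add_assoc]
    exact le_add_of_nonneg_right (by positivity)
  have cJ : Tendsto (fun n => J (q n)) atTop (𝓝 (J p)) := squeeze J fun n => by
    have := hpos n
    unfold discrepancy
    rw [add_comm |v _ - _|, add_assoc, add_assoc, add_assoc]
    exact le_add_of_nonneg_right (by positivity)
  have cG : Tendsto (fun n => G (q n)) atTop (𝓝 (G p)) := squeeze G fun n => by
    have := hpos n
    unfold discrepancy
    rw [add_assoc, add_comm _ ‖_‖, add_assoc]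
    exact le_add_of_nonneg_right (by positivity)
  have cχ : Tendsto (fun n => heav (q n)) atTop (𝓝 (heav p)) := squeeze heav fun n => by
    have := hpos n
    unfold discrepancy
    rw [add_comm _ |heav (p - _) - heav p|, add_assoc]
    exact le_add_of_nonneg_right (by positivity)
  have csub : Tendsto (fun n => w p - v (q n)) atTop (𝓝 (w p - v p)) :=
    tendsto_const_nhds.sub cv
  -- the entropy flux at `p`
  have cflux : ∀ {a : ℕ → ℝ} {a₀ : ℝ}, Tendsto a atTop (𝓝 a₀) →
      Tendsto (fun n => flux f J p (a n)) atTop (𝓝 (flux f J p a₀)) := fun ha =>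
    ((hf.continuous.tendsto _).comp (ha.add_const (J p))).const_smul (heav p)
  have ck : Tendsto (fun n => kflux f J p (w p) (v (q n))) atTop (𝓝 (kflux f J p (w p) (v p))) :=
    csub.abs.prodMk_nhds (tendsto_sign_smul csub (tendsto_const_nhds.sub (cflux cv))
      fun h0 => by rw [sub_eq_zero.1 h0, sub_self])
  -- the source
  have csrc : Tendsto (fun n => source f J G p (v (q n)) - source f J G (q n) (w p)) atTop
      (𝓝 (source f J G p (v p) - source f J G p (w p))) := by
    refine Tendsto.sub ?_ ?_
    · exact (((hf'.tendsto _).comp (cv.add_const (J p))).inner tendsto_const_nhds).const_mul _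
    · exact cχ.mul (((hf'.tendsto _).comp (cJ.const_add (w p))).inner cG)
  -- the scaled increment of the flux
  have hder : Tendsto (fun n => (h n)⁻¹ * (J p - J (s n))) atTop (𝓝 (inner ℝ (G p) r.2)) := by
    have h1 : HasDerivAt (fun τ : ℝ => J (p.1, p.2 - τ • r.2)) (-(inner ℝ (G p) r.2)) 0 := by
      have h2 : HasDerivAt (fun τ : ℝ => p.2 - τ • r.2) (-r.2) 0 := by
        simpa using ((hasDerivAt_id (0 : ℝ)).smul_const r.2).const_sub p.2
      have h3 : HasFDerivAt (fun y => J (p.1, y)) (InnerProductSpace.toDual ℝ (E N) (G p))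
          (p.2 - (0 : ℝ) • r.2) := by
        simpa using hgrad.hasFDerivAt
      have h4 := h3.comp_hasDerivAt 0 h2
      have h9 : InnerProductSpace.toDual ℝ (E N) (G p) (-r.2) = -(inner ℝ (G p) r.2) := by simp
      rw [h9] at h4
      exact h4
    have h5 := hasDerivAt_iff_tendsto_slope_zero.1 h1
    have h6 : Tendsto h atTop (𝓝[≠] 0) :=
      tendsto_nhdsWithin_iff.2 ⟨hh, Eventually.of_forall fun n => (hh0 n).ne'⟩
    have h7 := (h5.comp h6).neg
    rw [neg_neg] at h7
    refine h7.congr fun n => ?_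
    have h8 : s n = (p.1, p.2 - h n • r.2) := by ext <;> simp [hs]
    simp only [Function.comp_apply, zero_add, zero_smul, sub_zero, smul_eq_mul, h8]
    ring
  have cJs : Tendsto (fun n => J (s n)) atTop (𝓝 (J p)) := by
    have h1 := (hh.mul hder).const_sub (J p)
    rw [zero_mul, sub_zero] at h1
    refine h1.congr fun n => ?_
    field_simp [(hh0 n).ne']
    ring
  have hhs : ∀ n, heav (s n) = heav p := fun n => by simp [heav, hs]
  have cinc : ∀ {a : ℕ → ℝ} {a₀ : ℝ}, Tendsto a atTop (𝓝 a₀) →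
      Tendsto (fun n => (h n)⁻¹ • (flux f J p (a n) - flux f J (s n) (a n))) atTop
        (𝓝 (heav p • (inner ℝ (G p) r.2 • deriv f (a₀ + J p)))) := fun {a a₀} ha => by
    refine ((tendsto_inv_smul_increment hf ha cJs hder fun n => (hh0 n).ne').const_smul
      (heav p)).congr fun n => ?_
    simp only [flux, hhs, ← smul_sub]
    rw [smul_comm]
  have ctime : Tendsto (fun n => (h n)⁻¹ • ((flux f J (s n) (w p) - flux f J (s n) (v (q n)))
      - (flux f J (q n) (w p) - flux f J (q n) (v (q n))))) atTop (𝓝 0) := by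
    refine squeeze_zero_norm (fun n => ?_) (by simpa using hX.const_mul (2 * (L : ℝ)))
    have b3 := norm_flux_time_increment_le (J := J) hL (s n) (q n) (w p) (v (q n))
    rw [hhs] at b3
    have hL0 : (0 : ℝ) ≤ L := L.2
    have b4 : (h n)⁻¹ * (|heav p - heav (q n)| * (|w p| + |v (q n)|) + |J (s n) - J (q n)|)
        ≤ discrepancy J G w v (ε n) (h n) p r := by
      have := hpos n
      unfold discrepancy
      exact le_add_of_nonneg_left (by positivity)
    rw [norm_smul, Real.norm_of_nonneg (inv_nonneg.2 (hpos n))]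
    calc _ ≤ (h n)⁻¹ * (2 * L * (|heav p - heav (q n)| * (|w p| + |v (q n)|)
          + |J (s n) - J (q n)|)) := mul_le_mul_of_nonneg_left b3 (inv_nonneg.2 (hpos n))
      _ = 2 * L * ((h n)⁻¹ * (|heav p - heav (q n)| * (|w p| + |v (q n)|)
          + |J (s n) - J (q n)|)) := by ring
      _ ≤ _ := mul_le_mul_of_nonneg_left b4 (by positivity)
  have ctot : Tendsto (fun n => (h n)⁻¹ • ((flux f J p (w p) - flux f J p (v (q n)))
      - (flux f J (q n) (w p) - flux f J (q n) (v (q n))))) atTop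
      (𝓝 (heav p • (inner ℝ (G p) r.2 • deriv f (w p + J p)
        - inner ℝ (G p) r.2 • deriv f (v p + J p)))) := by
    have h1 := ((cinc (tendsto_const_nhds (x := w p))).sub (cinc cv)).add ctime
    rw [add_zero, ← smul_sub] at h1
    refine h1.congr fun n => ?_
    rw [← smul_sub, ← smul_add]
    congr 1
    abel
  have csg := tendsto_sign_smul csub ctot fun h0 => by
    rw [sub_eq_zero.1 h0, sub_self, smul_zero]
  refine Tendsto.sub (Tendsto.add ?_ ?_) ?_
  · exact (((fderiv ℝ ψ p).continuous.tendsto _).comp ck).const_mul _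
  · exact (((fderiv ℝ κ r).continuous.tendsto _).comp
      (tendsto_const_nhds.prodMk_nhds csg)).const_mul _
  · exact (tendsto_sign_smul csub csrc fun h0 => by
      rw [sub_eq_zero.1 h0, sub_self]).mul_const _

/-- Integration by parts: the linear function `⟨g, z⟩` has derivative `⟨g, c⟩` in the direction `(0,
c)`, and `κ` has mass one. -/
theorem integral_fderiv_inner_smul {κ : ℝ × E N → ℝ} (hκ : ContDiff ℝ (⊤ : ℕ∞) κ)
    (hκc : HasCompactSupport κ) (hκ1 : ∫ r, κ r = 1) (g c : E N) :
    Integrable (fun r : ℝ × E N => fderiv ℝ κ r (0, inner ℝ g r.2 • c)) ∧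
      ∫ r : ℝ × E N, fderiv ℝ κ r (0, inner ℝ g r.2 • c) = -inner ℝ g c := by
  have hκ' : Continuous (fderiv ℝ κ) := hκ.continuous_fderiv (by simp)
  have heq : ∀ r : ℝ × E N, fderiv ℝ κ r (0, inner ℝ g r.2 • c)
      = inner ℝ g r.2 * fderiv ℝ κ r (0, c) := fun r => by
    rw [show ((0 : ℝ), inner ℝ g r.2 • c) = inner ℝ g r.2 • ((0 : ℝ), c) by simp, map_smul,
      smul_eq_mul]
  simp only [heq]
  set ℓ : (ℝ × E N) →L[ℝ] ℝ := (innerSL ℝ g).comp (ContinuousLinearMap.snd ℝ ℝ (E N)) with hℓ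
  have hℓa : ∀ r, inner ℝ g r.2 = ℓ r := fun r => by simp [hℓ]
  simp only [hℓa]
  have hcs : HasCompactSupport fun r => fderiv ℝ κ r (0, c) :=
    (hκc.fderiv (𝕜 := ℝ)).comp_left (g := fun A : (ℝ × E N) →L[ℝ] ℝ => A (0, c)) (by simp)
  have hint : Integrable fun r => ℓ r * fderiv ℝ κ r (0, c) :=
    (ℓ.continuous.mul (hκ'.clm_apply continuous_const)).integrable_of_hasCompactSupport
      hcs.mul_left
  refine ⟨hint, ?_⟩
  have hfd : ∀ r, fderiv ℝ ℓ r (0, c) = inner ℝ g c := fun r => by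
    rw [ContinuousLinearMap.fderiv]; simp [hℓ]
  rw [integral_mul_fderiv_eq_neg_fderiv_mul_of_integrable (μ := volume) ?_ hint ?_
    (fun x _ => ℓ.differentiableAt) (fun x _ => hκ.differentiable (by simp) x)]
  · simp only [hfd]
    rw [integral_const_mul, hκ1, mul_one]
  · simp only [hfd]
    exact (hκ.continuous.integrable_of_hasCompactSupport hκc).const_mul _
  · exact (ℓ.continuous.mul hκ.continuous).integrable_of_hasCompactSupport hκc.mul_left

/-- The heart of the cancellation: averaging the flux term over the mollifier gives `-sgn(w -
v)(f'(w + J) - f'(v + J)) · G`, exactly the opposite of the source contribution. -/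
theorem integral_limitDoubled {f : ℝ → E N} {J : ℝ × E N → ℝ} {G : ℝ × E N → E N}
    {ψ κ w v : ℝ × E N → ℝ} (hκ : ContDiff ℝ (⊤ : ℕ∞) κ)
    (hκc : HasCompactSupport κ) (hκ1 : ∫ r, κ r = 1) (p : ℝ × E N) :
    ∫ r, limitDoubled f J G ψ κ w v p r = fderiv ℝ ψ p (kflux f J p (w p) (v p)) := by
  have hκi := hκ.continuous.integrable_of_hasCompactSupport (μ := volume) hκc
  set c : E N := Real.sign (w p - v p) • (heav p • (deriv f (w p + J p) - deriv f (v p + J p)))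
    with hc
  obtain ⟨hi, he⟩ := integral_fderiv_inner_smul hκ hκc hκ1 (G p) c
  have heq : ∀ r, limitDoubled f J G ψ κ w v p r
      = κ r * fderiv ℝ ψ p (kflux f J p (w p) (v p))
        + ψ p * fderiv ℝ κ r (0, inner ℝ (G p) r.2 • c)
        - (Real.sign (w p - v p) • (source f J G p (v p) - source f J G p (w p)) * ψ p) * κ r :=
    fun r => by
    unfold limitDoubled
    rw [← smul_sub, smul_comm (heav p), smul_comm (Real.sign _), ← hc, mul_assoc _ (ψ p)]
  have hadd : Integrable fun r : ℝ × E N => κ r * fderiv ℝ ψ p (kflux f J p (w p) (v p))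
      + ψ p * fderiv ℝ κ r (0, inner ℝ (G p) r.2 • c) := (hκi.mul_const _).add (hi.const_mul _)
  simp only [heq]
  rw [integral_sub hadd (hκi.const_mul _),
    integral_add (hκi.mul_const _) (hi.const_mul _), integral_mul_const, integral_const_mul,
    integral_const_mul, hκ1, he, hc]
  simp only [source, inner_smul_right, inner_sub_right, real_inner_comm, smul_eq_mul]
  ring

theorem measurable_scaledDoubled {f : ℝ → E N} {J : ℝ × E N → ℝ} {G : ℝ × E N → E N}
    {ψ κ w v : ℝ × E N → ℝ} (hf : ContDiff ℝ 1 f) (hJ : Measurable J) (hG : Measurable G)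
    (hw : Measurable w) (hv : Measurable v) (hψ : ContDiff ℝ (⊤ : ℕ∞) ψ)
    (hκ : ContDiff ℝ (⊤ : ℕ∞) κ) (ε h : ℝ) :
    Measurable fun z : (ℝ × E N) × (ℝ × E N) =>
      scaledDoubled f J G ψ κ w v ε h z.1 z.2 := by
  have hψ'c : Continuous (fderiv ℝ ψ) := hψ.continuous_fderiv (by simp)
  have hκ'c : Continuous (fderiv ℝ κ) := hκ.continuous_fderiv (by simp)
  have hm1 : Measurable fun z : (ℝ × E N) × (ℝ × E N) => z.1 := measurable_fst
  have hm2 : Measurable fun z : (ℝ × E N) × (ℝ × E N) => z.2 := measurable_snd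
  have hmq : Measurable fun z : (ℝ × E N) × (ℝ × E N) => z.1 - dil N ε h z.2 :=
    hm1.sub ((dil N ε h).continuous.measurable.comp hm2)
  have hwp : Measurable fun z : (ℝ × E N) × (ℝ × E N) => w z.1 := hw.comp hm1
  have hvq : Measurable fun z : (ℝ × E N) × (ℝ × E N) => v (z.1 - dil N ε h z.2) := hv.comp hmq
  have hfl : ∀ {p : (ℝ × E N) × (ℝ × E N) → ℝ × E N} {a : (ℝ × E N) × (ℝ × E N) → ℝ},
      Measurable p → Measurable a → Measurable fun z => flux f J (p z) (a z) :=
    fun hp ha => measurable_flux hf.continuous hJ hp ha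
  have hsg : Measurable fun z : (ℝ × E N) × (ℝ × E N) =>
      Real.sign (w z.1 - v (z.1 - dil N ε h z.2)) := measurable_sign.comp (hwp.sub hvq)
  have hψm : Measurable fun z : (ℝ × E N) × (ℝ × E N) => ψ z.1 :=
    hψ.continuous.measurable.comp hm1
  have hκm : Measurable fun z : (ℝ × E N) × (ℝ × E N) => κ z.2 :=
    hκ.continuous.measurable.comp hm2
  have hinc := ((((hfl hm1 hwp).sub (hfl hm1 hvq)).sub
    ((hfl hmq hwp).sub (hfl hmq hvq))).const_smul h⁻¹)
  refine ((hκm.mul (measurable_clm_apply (hψ'c.measurable.comp hm1)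
    (measurable_kflux hf.continuous hJ hm1 hwp hvq))).add
    (hψm.mul (measurable_clm_apply (hκ'c.measurable.comp hm2)
      (measurable_const.prodMk (hsg.smul hinc))))).sub ?_
  exact (hsg.smul ((measurable_source hf hJ hG hm1 hvq).sub
    (measurable_source hf hJ hG hmq hwp))).mul (hψm.mul hκm)

/-- The rescaled doubled integrals are nonnegative and converge by dominated convergence; averaging
the limit over the mollifier removes every term containing `G`. -/
theorem kato_inequality {T : ℝ} {f : ℝ → E N} {L : ℝ≥0} {J : ℝ × E N → ℝ}
    {G : ℝ × E N → E N} {m : ℝ → ℝ} {w v : ℝ × E N → ℝ} (hf : ContDiff ℝ 1 f)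
    (hL : LipschitzWith L f) (hJ : HasSpatialGradient J G m)
    (hw : Measurable w) (hwi : LocallyIntegrable w) (hv : Measurable v)
    (hvi : LocallyIntegrable v) (hwK : IsKruzhkov T f J G w) (hvK : IsKruzhkov T f J G v)
    {ψ : ℝ × E N → ℝ} (hψ : ContDiff ℝ (⊤ : ℕ∞) ψ) (hψc : HasCompactSupport ψ)
    (hψT : tsupport ψ ⊆ Ioo (-T) T ×ˢ univ) (hψ0 : ∀ p, 0 ≤ ψ p) :
    0 ≤ ∫ p, fderiv ℝ ψ p (kflux f J p (w p) (v p)) := by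
  set K := tsupport ψ with hKdef
  have hK : IsCompact K := hψc
  have hO : IsOpen (Ioo (-T) T ×ˢ (univ : Set (E N))) := isOpen_Ioo.prod isOpen_univ
  obtain ⟨δ₀, hδ₀, hthick⟩ := hK.exists_cthickening_subset_open hO hψT
  -- the mollifier
  let b : ContDiffBump (0 : ℝ × E N) := ⟨1 / 2, 1, by norm_num, by norm_num⟩
  set κ : ℝ × E N → ℝ := b.normed volume with hκdef
  have hκ : ContDiff ℝ (⊤ : ℕ∞) κ := b.contDiff_normed
  have hκc : HasCompactSupport κ := b.hasCompactSupport_normed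
  have hκ1 : ∫ r, κ r = 1 := b.integral_normed
  have hκ0 : ∀ r, 0 ≤ κ r := b.nonneg_normed
  set B := Metric.closedBall (0 : ℝ × E N) 1 with hBdef
  have hκB : tsupport κ = B := b.tsupport_normed_eq
  have hBc : IsCompact B := isCompact_closedBall _ _
  have hψ'c : Continuous (fderiv ℝ ψ) := hψ.continuous_fderiv (by simp)
  have hκ'c : Continuous (fderiv ℝ κ) := hκ.continuous_fderiv (by simp)
  obtain ⟨C1, hC1⟩ := hψ.continuous.bounded_above_of_compact_support hψc
  obtain ⟨C2, hC2⟩ := hψ'c.bounded_above_of_compact_support (hψc.fderiv (𝕜 := ℝ))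
  obtain ⟨C3, hC3⟩ := hκ.continuous.bounded_above_of_compact_support hκc
  obtain ⟨C4, hC4⟩ := hκ'c.bounded_above_of_compact_support (hκc.fderiv (𝕜 := ℝ))
  have hz1 : ∀ p, p ∉ K → ψ p = 0 := fun p hp => image_eq_zero_of_notMem_tsupport hp
  have hz2 : ∀ p, p ∉ K → fderiv ℝ ψ p = 0 := fun p hp =>
    image_eq_zero_of_notMem_tsupport fun h => hp (tsupport_fderiv_subset ℝ h)
  have hz3 : ∀ r, r ∉ B → κ r = 0 := fun p hp =>
    image_eq_zero_of_notMem_tsupport (by rwa [hκB])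
  have hz4 : ∀ r, r ∉ B → fderiv ℝ κ r = 0 := fun p hp =>
    image_eq_zero_of_notMem_tsupport fun h => hp (hκB ▸ tsupport_fderiv_subset ℝ h)
  -- the scales
  have hex : ∀ n : ℕ, ∃ ε h : ℝ, 0 < ε ∧ ε ≤ h ∧ h ≤ min δ₀ ((1 / 2) ^ n) ∧
      ∫⁻ z, ENNReal.ofReal (discrepancy J G w v ε h z.1 z.2)
        ∂((volume.restrict K).prod (volume.restrict B))
        ≤ ENNReal.ofReal (min δ₀ ((1 / 2) ^ n)) := fun n =>
    exists_scales_discrepancy_le hJ.measurable hJ.locallyIntegrable hJ.measurable_grad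
      hJ.locallyIntegrable_grad hw hwi hv hvi hK (by positivity)
  choose ε h hε0 hεh hhδ hX using hex
  have hh0 : ∀ n, 0 < h n := fun n => (hε0 n).trans_le (hεh n)
  have hhlim : Tendsto h atTop (𝓝 0) :=
    squeeze_zero (fun n => (hh0 n).le) (fun n => (hhδ n).trans (min_le_right _ _))
      (tendsto_pow_atTop_nhds_zero_of_lt_one (by norm_num) (by norm_num))
  set ν := (volume.restrict K).prod (volume.restrict B) with hν
  have hKfin : IsFiniteMeasure (volume.restrict K) :=
    ⟨by simpa using hK.measure_lt_top⟩
  have hBfin : IsFiniteMeasure (volume.restrict B) :=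
    ⟨by simpa using hBc.measure_lt_top⟩
  obtain ⟨Y, hYi, hYb, hX0⟩ := exists_integrable_bound_of_lintegral_le_geometric (μ := ν)
    (X := fun n z => discrepancy J G w v (ε n) (h n) z.1 z.2)
    (fun n => (measurable_discrepancy hJ.measurable hJ.measurable_grad hw hv _ _).aemeasurable)
    (fun n z => discrepancy_nonneg (hh0 n) _ _)
    (fun n => (hX n).trans (ENNReal.ofReal_le_ofReal (min_le_right _ _)))
  -- transfer of almost everywhere statements
  have hae : ∀ {q : ℝ → Prop}, (∀ᵐ t, q t) → ∀ᵐ z ∂ν, q z.1.1 := fun hq => by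
    have h1 : ∀ᵐ p : ℝ × E N, _ :=
      Measure.quasiMeasurePreserving_fst (μ := volume) (ν := volume) |>.ae hq
    exact Measure.quasiMeasurePreserving_fst.ae (ae_restrict_of_ae h1)
  have haeB : ∀ᵐ z ∂ν, z.2 ∈ B :=
    Measure.quasiMeasurePreserving_snd.ae (ae_restrict_mem hBc.measurableSet)
  -- domination
  set Z : ℕ → (ℝ × E N) × (ℝ × E N) → ℝ :=
    fun n z => scaledDoubled f J G ψ κ w v (ε n) (h n) z.1 z.2 with hZ
  set D : (ℝ × E N) × (ℝ × E N) → ℝ := fun z =>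
      C3 * (C2 * ((1 + L) * (|w z.1| + (|v z.1| + Y z)))) + C1 * (C4 * (2 * L * (m z.1.1 + Y z)))
        + (L * ‖G z.1‖ + L * (‖G z.1‖ + Y z)) * (C1 * C3) with hD
  have hDi : Integrable D ν := by
    have i1 : Integrable (fun z : (ℝ × E N) × (ℝ × E N) => |w z.1|) ν :=
      (hwi.integrableOn_isCompact hK).norm.comp_fst _
    have i2 : Integrable (fun z : (ℝ × E N) × (ℝ × E N) => |v z.1|) ν :=
      (hvi.integrableOn_isCompact hK).norm.comp_fst _
    have i3 : Integrable (fun z : (ℝ × E N) × (ℝ × E N) => ‖G z.1‖) ν :=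
      (hJ.locallyIntegrable_grad.integrableOn_isCompact hK).norm.comp_fst _
    have i4 : Integrable (fun z : (ℝ × E N) × (ℝ × E N) => m z.1.1) ν :=
      (hJ.locallyIntegrable_bound.integrableOn_isCompact hK).comp_fst _
    exact (((((i1.add (i2.add hYi)).const_mul _).const_mul _).const_mul _).add
      ((((i4.add hYi).const_mul _).const_mul _).const_mul _)).add
      (((i3.const_mul _).add ((i3.add hYi).const_mul _)).mul_const _)
  have hbound : ∀ n, ∀ᵐ z ∂ν, ‖Z n z‖ ≤ D z := fun n => by
    filter_upwards [hYb, haeB, hae hJ.abs_sub_le, hae hJ.norm_grad_le] with z y1 y2 y3 y4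
    have hdil : z.1 - dil N 0 (h n) z.2 = (z.1.1, z.1.2 - h n • z.2.2) := by ext <;> simp
    refine abs_scaledDoubled_le hL hC1 hC2 hC3 hC4 (hh0 n) (by simpa [hBdef] using y2)
      ((norm_nonneg _).trans (y4 0)) ?_ (y1 n)
    rw [hdil]
    simpa using y3 z.1.2 (z.1.2 - h n • z.2.2)
  have hlim : ∀ᵐ z ∂ν, Tendsto (fun n => Z n z) atTop
      (𝓝 (limitDoubled f J G ψ κ w v z.1 z.2)) := by
    filter_upwards [hX0, hae hJ.hasGradientAt] with z y1 y2
    exact tendsto_scaledDoubled hf hL hh0 hhlim (y2 z.1.2) y1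
  have hZm : ∀ n, Measurable (Z n) := fun n =>
    measurable_scaledDoubled hf hJ.measurable hJ.measurable_grad hw hv hψ hκ _ _
  have hDCT := tendsto_integral_of_dominated_convergence D
    (fun n => (hZm n).aestronglyMeasurable) hDi hbound hlim
  -- restriction to the supports
  have hset : ∀ F : (ℝ × E N) → (ℝ × E N) → ℝ, (∀ p r, p ∉ K → F p r = 0) →
      (∀ p r, r ∉ B → F p r = 0) → Integrable (fun z : (ℝ × E N) × (ℝ × E N) => F z.1 z.2) ν →
      ∫ z, F z.1 z.2 ∂ν = ∫ p, ∫ r, F p r := fun F h1 h2 hi => by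
    rw [hν, integral_prod _ hi]
    have h3 : ∀ p, ∫ r in B, F p r = ∫ r, F p r := fun p =>
      setIntegral_eq_integral_of_forall_compl_eq_zero fun r hr => h2 p r hr
    simp only [h3]
    exact setIntegral_eq_integral_of_forall_compl_eq_zero fun p hp => by simp [h1 p _ hp]
  have hZi : ∀ n, Integrable (Z n) ν := fun n =>
    hDi.mono' (hZm n).aestronglyMeasurable (hbound n)
  have hnonneg : ∀ n, 0 ≤ ∫ z, Z n z ∂ν := fun n => by
    rw [hset (fun p r => scaledDoubled f J G ψ κ w v (ε n) (h n) p r)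
      (fun p r hp => by simp [scaledDoubled, hz1 p hp, hz2 p hp])
      (fun p r hr => by simp [scaledDoubled, hz3 r hr, hz4 r hr]) (hZi n)]
    obtain ⟨c, hc0, hc⟩ := exists_integral_eq_mul_integral_dil (N := N) (hε0 n) (hh0 n)
    set η : ℝ × E N → ℝ := fun y => κ (dil N (ε n)⁻¹ (h n)⁻¹ y) with hη
    have hηB : tsupport η ⊆ dil N (ε n) (h n) '' B := by
      refine closure_minimal (fun y hy => ?_)
        (hBc.image (dil N (ε n) (h n)).continuous).isClosed
      refine ⟨dil N (ε n)⁻¹ (h n)⁻¹ y, ?_, ?_⟩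
      · by_contra hcon
        exact hy (hz3 _ hcon)
      · have := dil_inv_dil (inv_ne_zero (hε0 n).ne') (inv_ne_zero (hh0 n).ne') y
        rwa [inv_inv, inv_inv] at this
    have hpos := integral_doubled_nonneg (ψ := ψ) (η := η) hf hL hJ.measurable hJ.measurable_grad
      hJ.locallyIntegrable_grad hw hwi hv hvi hwK hvK hψ hψc hψ0
      (hκ.comp (dil N (ε n)⁻¹ (h n)⁻¹).contDiff)
      (HasCompactSupport.of_support_subset_isCompact
        (hBc.image (dil N (ε n) (h n)).continuous) (subset_closure.trans hηB))
      (fun y => hκ0 _) hψT (fun p hp r hr => by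
        obtain ⟨r', hr', rfl⟩ := hηB hr
        refine hthick (Metric.mem_cthickening_of_dist_le _ p _ _ hp ?_)
        have h1 := norm_dil_le (hε0 n).le (hεh n) r'
        have h2 : ‖r'‖ ≤ 1 := by simpa [hBdef] using hr'
        have h3 : h n ≤ δ₀ := (hhδ n).trans (min_le_left _ _)
        have h4 := hh0 n
        rw [dist_eq_norm, sub_sub_cancel_left, norm_neg]
        nlinarith [norm_nonneg r'])
    have heq : ∀ p, ∫ q, doubled f J G ψ η w v p q
        = c * ∫ r, scaledDoubled f J G ψ κ w v (ε n) (h n) p r := fun p => by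
      rw [hc _ p]
      congr 2
      funext r
      exact doubled_dil_eq (hκ.differentiable (by simp)) (hε0 n) (hh0 n) p r
    simp only [heq] at hpos
    rw [integral_const_mul] at hpos
    exact nonneg_of_mul_nonneg_right hpos hc0
  have hlimi : Integrable (fun z : (ℝ × E N) × (ℝ × E N) =>
      limitDoubled f J G ψ κ w v z.1 z.2) ν := by
    refine hDi.mono' (aestronglyMeasurable_of_tendsto_ae atTop
      (fun n => (hZm n).aestronglyMeasurable) hlim) ?_
    filter_upwards [hlim, ae_all_iff.2 hbound] with z h1 h2
    exact le_of_tendsto h1.norm (Eventually.of_forall h2)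
  have hfin := ge_of_tendsto' hDCT hnonneg
  rw [hset (fun p r => limitDoubled f J G ψ κ w v p r)
      (fun p r hp => by simp [limitDoubled, hz1 p hp, hz2 p hp])
      (fun p r hr => by simp [limitDoubled, hz3 r hr, hz4 r hr]) hlimi] at hfin
  simpa only [integral_limitDoubled hκ hκc hκ1] using hfin

/-! ### Weighted stability estimate -/

/-- A smooth approximation of the indicator of `[t₁, t₀]`. -/
theorem exists_smooth_cutoff {k : ℝ → ℝ} (hk : ContDiff ℝ (⊤ : ℕ∞) k) (hk0 : ∀ s, 0 ≤ k s)
    {ρ t₁ t₀ : ℝ} (hkρ : ∀ s, ρ < |s| → k s = 0) (h10 : t₁ ≤ t₀) :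
    ∃ θ : ℝ → ℝ, ContDiff ℝ (⊤ : ℕ∞) θ ∧ (∀ t, 0 ≤ θ t) ∧
      (∀ t, t ∉ Icc (t₁ - ρ) (t₀ + ρ) → θ t = 0) ∧
      ∀ t, deriv θ t = k (t - t₁) - k (t - t₀) := by
  set Φ : ℝ → ℝ := fun t => ∫ s in (0 : ℝ)..t, k s with hΦ
  have hd : ∀ t, HasDerivAt Φ (k t) t := fun t =>
    intervalIntegral.integral_hasDerivAt_right (hk.continuous.intervalIntegrable _ _)
      hk.continuous.aestronglyMeasurable.stronglyMeasurableAtFilter hk.continuous.continuousAt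
  have hΦs : ContDiff ℝ (⊤ : ℕ∞) Φ := by
    refine contDiff_infty_iff_deriv.2 ⟨fun t => (hd t).differentiableAt, ?_⟩
    rw [show deriv Φ = k from funext fun t => (hd t).deriv]
    exact hk
  have heq : ∀ t, Φ (t - t₁) - Φ (t - t₀) = ∫ s in (t - t₀)..(t - t₁), k s := fun t =>
    intervalIntegral.integral_interval_sub_left (hk.continuous.intervalIntegrable _ _)
      (hk.continuous.intervalIntegrable _ _)
  refine ⟨fun t => Φ (t - t₁) - Φ (t - t₀), ?_, fun t => ?_, fun t ht => ?_, fun t => ?_⟩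
  · exact (hΦs.comp (contDiff_id.sub contDiff_const)).sub
      (hΦs.comp (contDiff_id.sub contDiff_const))
  · simp only [heq]
    exact intervalIntegral.integral_nonneg (by linarith) fun s _ => hk0 s
  · simp only [heq]
    rw [intervalIntegral.integral_of_le (by linarith)]
    refine setIntegral_eq_zero_of_forall_eq_zero fun s hs => hkρ s ?_
    by_contra hcon
    have h1 := abs_le.1 (not_lt.1 hcon)
    exact ht ⟨by linarith [hs.2, h1.1], by linarith [hs.1, h1.2]⟩
  · have h1 := ((hd (t - t₁)).comp_sub_const t t₁).sub ((hd (t - t₀)).comp_sub_const t t₀)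
    exact h1.deriv

/-- A locally integrable function on `(-T, T)` with nonpositive distributional derivative is
bounded on `(0, T)` by its bounds on `(-T, 0)`. -/
theorem ae_le_of_weakly_antitone {T B : ℝ} (hT : 0 < T) {A : ℝ → ℝ} (hA : LocallyIntegrable A)
    (hweak : ∀ θ : ℝ → ℝ, ContDiff ℝ (⊤ : ℕ∞) θ → HasCompactSupport θ →
      tsupport θ ⊆ Ioo (-T) T → (∀ t, 0 ≤ θ t) → 0 ≤ ∫ t, deriv θ t * A t)
    (hneg : ∀ᵐ t : ℝ, t ∈ Ioo (-T) 0 → A t ≤ B) :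
    ∀ᵐ t : ℝ, t ∈ Ioo 0 T → A t ≤ B := by
  -- The ratio of outer to inner radius stays equal to 2, as convergence of the mollifications at
  -- almost every point requires.
  let b : ℕ → ContDiffBump (0 : ℝ) := fun n =>
    ⟨1 / (n + 2), 2 / (n + 2), by positivity, by gcongr; norm_num⟩
  have hbr : ∀ n, (b n).rOut = 2 / (n + 2) := fun n => rfl
  have hb0 : Tendsto (fun n => (b n).rOut) atTop (𝓝 0) := by
    simp only [hbr]
    have h1 : Tendsto (fun n : ℕ => (2 : ℝ) / ((n : ℝ) + 2)) atTop (𝓝 0) :=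
      tendsto_const_nhds.div_atTop (tendsto_atTop_add_const_right _ _ tendsto_natCast_atTop_atTop)
    exact h1
  have hconv := ContDiffBump.ae_convolution_tendsto_right_of_locallyIntegrable (μ := volume)
    (φ := b) (l := atTop) (K := 2) hb0 (Eventually.of_forall fun n => by
      change (2 : ℝ) / (n + 2) ≤ 2 * (1 / (n + 2)); rw [mul_one_div]) hA
  filter_upwards [hconv] with t₀ ht₀ hmem
  refine le_of_tendsto ht₀ ?_
  have hev : ∀ᶠ n in atTop, (b n).rOut < min (t₀) (min (T - t₀) (T / 2)) :=
    hb0.eventually (gt_mem_nhds (lt_min hmem.1 (lt_min (sub_pos.2 hmem.2) (by positivity))))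
  filter_upwards [hev] with n hn
  have hn1 : (b n).rOut < T - t₀ := hn.trans_le ((min_le_right _ _).trans (min_le_left _ _))
  have hn2 : (b n).rOut < T / 2 := hn.trans_le ((min_le_right _ _).trans (min_le_right _ _))
  set k : ℝ → ℝ := (b n).normed volume with hkdef
  set ρ := (b n).rOut with hρ
  have hρ0 : 0 < ρ := (b n).rOut_pos
  have hk : ContDiff ℝ (⊤ : ℕ∞) k := (b n).contDiff_normed
  have hk0 : ∀ s, 0 ≤ k s := (b n).nonneg_normed
  have hkc : HasCompactSupport k := (b n).hasCompactSupport_normed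
  have hk1 : ∫ s, k s = 1 := (b n).integral_normed
  have hkz : ∀ s, ρ ≤ |s| → k s = 0 := fun s hs => by
    by_contra hcon
    have h1 : s ∈ Function.support k := hcon
    rw [hkdef, ContDiffBump.support_normed_eq] at h1
    rw [mem_ball_zero_iff, Real.norm_eq_abs] at h1
    exact absurd h1 (not_lt.2 hs)
  have hkneg : ∀ s, k (-s) = k s := fun s => (b n).normed_neg s
  -- The derivative of `θ` is an approximate Dirac mass at `-T/2` minus one at `t₀`, so the
  -- hypothesis compares averages of `A` there. Any fixed point of `(-T, 0)` could replace `-T/2`.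
  obtain ⟨θ, hθ, hθ0, hθz, hθd⟩ := exists_smooth_cutoff hk hk0 (ρ := ρ) (t₁ := -(T / 2))
    (t₀ := t₀) (fun s hs => hkz s hs.le) (by linarith [hmem.1])
  have hsupp : tsupport θ ⊆ Icc (-(T / 2) - ρ) (t₀ + ρ) :=
    closure_minimal (fun t ht => by_contra fun h => ht (hθz t h)) isClosed_Icc
  have hw := hweak θ hθ (HasCompactSupport.of_support_subset_isCompact isCompact_Icc
    (subset_closure.trans hsupp))
    (hsupp.trans fun t ht => ⟨by linarith [ht.1], by linarith [ht.2]⟩) hθ0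
  have hshift : ∀ c : ℝ, Integrable fun t => k (t - c) * A t := fun c =>
    hA.integrable_smul_left_of_hasCompactSupport
      (hk.continuous.comp (continuous_id.sub continuous_const))
      (hkc.comp_homeomorph (Homeomorph.subRight c))
  simp only [hθd, sub_mul] at hw
  rw [integral_sub (hshift _) (hshift _)] at hw
  have hbnd : ∫ t, k (t - -(T / 2)) * A t ≤ B := by
    have h1 : ∫ t, k (t - -(T / 2)) * B = B := by
      rw [integral_mul_const, integral_sub_right_eq_self (μ := volume) k, hk1, one_mul]
    rw [← h1]
    refine integral_mono_ae (hshift _) ?_ ?_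
    · exact ((hk.continuous.integrable_of_hasCompactSupport hkc).comp_sub_right _).mul_const _
    · filter_upwards [hneg] with t ht
      by_cases hs : ρ ≤ |t - -(T / 2)|
      · simp only [hkz _ hs, zero_mul, le_refl]
      · have := abs_lt.1 (not_le.1 hs)
        exact mul_le_mul_of_nonneg_left
          (ht ⟨by linarith [this.1], by linarith [this.2]⟩) (hk0 _)
  rw [convolution_lsmul_swap]
  have heq : ∫ t, k (t₀ - t) • A t = ∫ t, k (t - t₀) * A t := by
    congr 1
    funext t
    rw [← hkneg, neg_sub, smul_eq_mul]
  rw [heq]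
  linarith

/-! ### The backward cone weight -/

/-- The profile `√(1 + |x|²)`. -/
def bracket (x : E N) : ℝ := √(1 + ‖x‖ ^ 2)

theorem contDiff_bracket : ContDiff ℝ (⊤ : ℕ∞) (bracket : E N → ℝ) :=
  (contDiff_const.add (contDiff_norm_sq ℝ)).sqrt fun x => by positivity

theorem norm_le_bracket (x : E N) : ‖x‖ ≤ bracket x :=
  Real.le_sqrt_of_sq_le (by linarith)

theorem abs_fderiv_bracket_le (x y : E N) : |fderiv ℝ bracket x y| ≤ ‖y‖ := by
  have hpos : (0 : ℝ) < 1 + ‖x‖ ^ 2 := by positivity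
  have h1 : HasFDerivAt (fun x : E N => 1 + ‖x‖ ^ 2) (2 • innerSL ℝ x) x :=
    (hasStrictFDerivAt_norm_sq x).hasFDerivAt.const_add 1
  have h2 := h1.sqrt hpos.ne'
  have h3 : fderiv ℝ bracket x y = inner ℝ x y / bracket x := by
    rw [show (bracket : E N → ℝ) = fun x => √(1 + ‖x‖ ^ 2) from rfl, h2.fderiv]
    simp only [smul_apply, innerSL_apply_apply, nsmul_eq_mul, Nat.cast_ofNat, smul_eq_mul]
    field_simp
  have hb : 0 < bracket x := Real.sqrt_pos.2 hpos
  rw [h3, abs_div, abs_of_pos hb, div_le_iff₀ hb]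
  refine (abs_real_inner_le_norm x y).trans ?_
  rw [mul_comm]
  exact mul_le_mul_of_nonneg_left (norm_le_bracket x) (norm_nonneg y)

/-- A smooth nonincreasing truncation of `e^{-r}`. -/
def expCut (R r : ℝ) : ℝ := Real.exp (-r) * Real.smoothTransition (R - r)

theorem contDiff_expCut (R : ℝ) : ContDiff ℝ (⊤ : ℕ∞) (expCut R) :=
  (Real.contDiff_exp.comp contDiff_neg).mul
    (Real.smoothTransition.contDiff.comp (contDiff_const.sub contDiff_id))

theorem expCut_nonneg (R r : ℝ) : 0 ≤ expCut R r :=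
  mul_nonneg (Real.exp_nonneg _) (Real.smoothTransition.nonneg _)

theorem expCut_le (R r : ℝ) : expCut R r ≤ Real.exp (-r) :=
  mul_le_of_le_one_right (Real.exp_nonneg _) (Real.smoothTransition.le_one _)

theorem expCut_eq_zero {R r : ℝ} (h : R ≤ r) : expCut R r = 0 := by
  rw [expCut, Real.smoothTransition.zero_of_nonpos (by linarith), mul_zero]

theorem expCut_antitone (R : ℝ) : Antitone (expCut R) := fun a b hab =>
  mul_le_mul (Real.exp_le_exp.2 (by linarith))
    (Real.smoothTransition.monotone (by linarith)) (Real.smoothTransition.nonneg _)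
    (Real.exp_nonneg _)

/-- The backward weight `H(√(1 + |x|²) + L t)`. -/
def coneWeight (L R : ℝ) (p : ℝ × E N) : ℝ := expCut R (bracket p.2 + L * p.1)

theorem contDiff_coneWeight (L R : ℝ) : ContDiff ℝ (⊤ : ℕ∞) (coneWeight L R : ℝ × E N → ℝ) :=
  (contDiff_expCut R).comp ((contDiff_bracket.comp contDiff_snd).add
    (contDiff_const.mul contDiff_fst))

theorem fderiv_coneWeight (L R : ℝ) (p y : ℝ × E N) :
    fderiv ℝ (coneWeight L R) p y
      = deriv (expCut R) (bracket p.2 + L * p.1) * (fderiv ℝ bracket p.2 y.2 + L * y.1) := by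
  have h1 : HasFDerivAt (fun p : ℝ × E N => bracket p.2 + L * p.1)
      ((fderiv ℝ bracket p.2).comp (ContinuousLinearMap.snd ℝ ℝ (E N))
        + L • ContinuousLinearMap.fst ℝ ℝ (E N)) p :=
    ((contDiff_bracket.differentiable (by simp) p.2).hasFDerivAt.comp p hasFDerivAt_snd).add
      (hasFDerivAt_fst.const_mul L)
  have h2 := ((contDiff_expCut R).differentiable (by simp)
    (bracket p.2 + L * p.1)).hasDerivAt.comp_hasFDerivAt p h1
  rw [show (coneWeight L R : ℝ × E N → ℝ) = expCut R ∘ fun p => bracket p.2 + L * p.1 from rfl,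
    h2.fderiv]
  simp [mul_add]

/-- The weight decreases along the entropy flux: finite speed of propagation. -/
theorem fderiv_coneWeight_kflux_nonpos {f : ℝ → E N} {L : ℝ≥0} (hL : LipschitzWith L f)
    {J : ℝ × E N → ℝ} (R : ℝ) (p : ℝ × E N) (a b : ℝ) :
    fderiv ℝ (coneWeight L R) p (kflux f J p a b) ≤ 0 := by
  rw [fderiv_coneWeight]
  refine mul_nonpos_of_nonpos_of_nonneg (expCut_antitone R).deriv_nonpos ?_
  have h1 := abs_fderiv_bracket_le p.2 (kflux f J p a b).2
  have h2 : ‖(kflux f J p a b).2‖ ≤ L * (kflux f J p a b).1 := by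
    simp only [kflux, norm_smul]
    exact (mul_le_of_le_one_left (norm_nonneg _) (abs_sign_le_one _)).trans
      (norm_flux_sub_le hL p a b)
  linarith [neg_abs_le (fderiv ℝ bracket p.2 (kflux f J p a b).2)]

theorem coneWeight_eq_zero {L R c : ℝ} (hL : 0 ≤ L) {p : ℝ × E N} (hp : -c ≤ p.1)
    (hx : R + L * c < ‖p.2‖) : coneWeight L R p = 0 :=
  expCut_eq_zero (by nlinarith [norm_le_bracket p.2])

/-- On the slab `|t| ≤ c` the truncated weight vanishes for `|x| > R + Lc`, so local integrability
suffices. -/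
theorem integrable_prod_coneWeight {L R : ℝ} (hL : 0 ≤ L) {d : ℝ × E N → ℝ}
    (hd : LocallyIntegrable d) (c : ℝ) :
    Integrable (fun p : ℝ × E N => d p * coneWeight L R p)
      ((volume.restrict (Icc (-c) c)).prod volume) := by
  have hS : IsCompact (Icc (-c) c ×ˢ Metric.closedBall (0 : E N) (R + L * c)) :=
    isCompact_Icc.prod (isCompact_closedBall _ _)
  have h1 : IntegrableOn (fun p : ℝ × E N => d p * coneWeight L R p)
      (Icc (-c) c ×ˢ Metric.closedBall (0 : E N) (R + L * c)) :=
    (hd.integrableOn_isCompact hS).mul_continuousOn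
      (contDiff_coneWeight L R).continuous.continuousOn hS
  have h2 : IntegrableOn (fun p : ℝ × E N => d p * coneWeight L R p)
      (Icc (-c) c ×ˢ (univ : Set (E N))) := by
    refine h1.of_forall_sdiff_eq_zero (measurableSet_Icc.prod MeasurableSet.univ) ?_
    rintro p ⟨⟨hp1, -⟩, hp2⟩
    have h3 : R + L * c < ‖p.2‖ := by
      by_contra h
      exact hp2 ⟨hp1, by simpa using not_lt.1 h⟩
    rw [coneWeight_eq_zero hL hp1.1 h3, mul_zero]
  rwa [IntegrableOn, Measure.volume_eq_prod, ← Measure.prod_restrict, Measure.restrict_univ] at h2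

/-- Testing with `θ(t)` times the cone weight discards the flux terms by their sign, so the
truncated weighted distance `A R` has nonpositive distributional derivative and inherits its bound
from negative times. Fatou's lemma then removes the truncation. -/
theorem weighted_estimate {T B : ℝ} (hT : 0 < T) {f : ℝ → E N} {L : ℝ≥0} (hL : LipschitzWith L f)
    {J w v : ℝ × E N → ℝ} (hJ : Measurable J)
    (hw : Measurable w) (hwi : LocallyIntegrable w) (hv : Measurable v)
    (hvi : LocallyIntegrable v)
    (hkato : ∀ ψ : ℝ × E N → ℝ, ContDiff ℝ (⊤ : ℕ∞) ψ → HasCompactSupport ψ →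
      tsupport ψ ⊆ Ioo (-T) T ×ˢ univ → (∀ p, 0 ≤ ψ p) →
      0 ≤ ∫ p, fderiv ℝ ψ p (kflux f J p (w p) (v p)))
    (hB : 0 ≤ B)
    (hneg : ∀ᵐ t : ℝ, t < 0 →
      ∫⁻ x, ENNReal.ofReal (|w (t, x) - v (t, x)| * Real.exp (-bracket x)) ≤ ENNReal.ofReal B) :
    ∀ᵐ t : ℝ, t ∈ Ioo 0 T →
      ∫⁻ x, ENNReal.ofReal (|w (t, x) - v (t, x)| * Real.exp (-bracket x))
        ≤ ENNReal.ofReal (Real.exp (2 * L * T) * B) := by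
  have hL0 : (0 : ℝ) ≤ L := L.2
  set d : ℝ × E N → ℝ := fun p => |w p - v p| with hddef
  have hd : LocallyIntegrable d := locallyIntegrable_norm (hwi.sub hvi)
  have hdm : Measurable d := (hw.sub hv).abs
  have hd0 : ∀ p, 0 ≤ d p := fun p => abs_nonneg _
  have hW0 : ∀ R (p : ℝ × E N), 0 ≤ coneWeight L R p := fun R p => expCut_nonneg _ _
  have hWc : ∀ R, Continuous (coneWeight L R : ℝ × E N → ℝ) := fun R =>
    (contDiff_coneWeight L R).continuous
  set A : ℝ → ℝ → ℝ := fun R t => ∫ x, d (t, x) * coneWeight L R (t, x) with hA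
  have hAi : ∀ R, LocallyIntegrable (A R) := fun R t => by
    refine ⟨Icc (-(|t| + 1)) (|t| + 1), ?_, ?_⟩
    · exact Icc_mem_nhds (by linarith [neg_abs_le t]) (by linarith [le_abs_self t])
    · exact (integrable_prod_coneWeight (R := R) hL0 hd (|t| + 1)).integral_prod_left
  have hweak : ∀ R, ∀ θ : ℝ → ℝ, ContDiff ℝ (⊤ : ℕ∞) θ → HasCompactSupport θ →
      tsupport θ ⊆ Ioo (-T) T → (∀ t, 0 ≤ θ t) → 0 ≤ ∫ t, deriv θ t * A R t := by
    intro R θ hθ hθc hθT hθ0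
    set S : Set (ℝ × E N) := tsupport θ ×ˢ Metric.closedBall (0 : E N) (R + L * T) with hSdef
    have hS : IsCompact S := hθc.prod (isCompact_closedBall _ _)
    set ψ : ℝ × E N → ℝ := fun p => θ p.1 * coneWeight L R p with hψdef
    have hmem : ∀ p : ℝ × E N, p.1 ∈ tsupport θ → coneWeight L R p ≠ 0 → p ∈ S := by
      intro p hp1 hp2
      refine ⟨hp1, ?_⟩
      by_contra h
      rw [mem_closedBall_zero_iff, not_le] at h
      exact hp2 (coneWeight_eq_zero hL0 (hθT hp1).1.le h)
    have hψS : Function.support ψ ⊆ S := fun p hp =>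
      hmem p (subset_tsupport θ (left_ne_zero_of_mul hp)) (right_ne_zero_of_mul hp)
    have hψ : ContDiff ℝ (⊤ : ℕ∞) ψ := (hθ.comp contDiff_fst).mul (contDiff_coneWeight L R)
    have hψc : HasCompactSupport ψ := HasCompactSupport.of_support_subset_isCompact hS hψS
    have h0 := hkato ψ hψ hψc
      ((closure_minimal hψS hS.isClosed).trans fun p hp => ⟨hθT hp.1, mem_univ _⟩)
      fun p => mul_nonneg (hθ0 _) (hW0 R p)
    have hψ' : Continuous (fderiv ℝ ψ) := hψ.continuous_fderiv (by simp)
    have hθ' : Continuous (deriv θ) := hθ.continuous_deriv (by simp)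
    have hlhs : Integrable fun p => fderiv ℝ ψ p (kflux f J p (w p) (v p)) := by
      have hmaj : Integrable fun p : ℝ × E N =>
          ‖fderiv ℝ ψ p‖ • ((1 + (L : ℝ)) * (|w p| + |v p|)) :=
        (((locallyIntegrable_norm hwi).add (locallyIntegrable_norm hvi)).smul
          (1 + (L : ℝ))).integrable_smul_left_of_hasCompactSupport hψ'.norm
          (hψc.fderiv (𝕜 := ℝ)).norm
      refine hmaj.mono' (measurable_clm_apply hψ'.measurable (measurable_kflux
        hL.continuous hJ measurable_id hw hv)).aestronglyMeasurable (Eventually.of_forall fun p => ?_)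
      exact ContinuousLinearMap.le_opNorm_of_le _ (norm_kflux_le hL p _ _)
    have hg : Continuous fun p : ℝ × E N => deriv θ p.1 * coneWeight L R p :=
      (hθ'.comp continuous_fst).mul (hWc R)
    have hrhs : Integrable fun p : ℝ × E N => (deriv θ p.1 * coneWeight L R p) • d p :=
      hd.integrable_smul_left_of_hasCompactSupport hg
        (HasCompactSupport.of_support_subset_isCompact hS fun p hp =>
          hmem p (tsupport_deriv_subset (subset_tsupport _ (left_ne_zero_of_mul hp)))
            (right_ne_zero_of_mul hp))
    have hle : ∀ p, fderiv ℝ ψ p (kflux f J p (w p) (v p))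
        ≤ (deriv θ p.1 * coneWeight L R p) • d p := by
      intro p
      have e1 : HasFDerivAt (fun p : ℝ × E N => θ p.1)
          (deriv θ p.1 • ContinuousLinearMap.fst ℝ ℝ (E N)) p :=
        (hθ.differentiable (by simp) p.1).hasDerivAt.comp_hasFDerivAt p hasFDerivAt_fst
      have e2 := e1.fun_mul ((contDiff_coneWeight (N := N) L R).differentiable (by simp) p).hasFDerivAt
      rw [hψdef, e2.fderiv]
      have e3 := mul_nonpos_of_nonneg_of_nonpos (hθ0 p.1)
        (fderiv_coneWeight_kflux_nonpos hL (J := J) R p (w p) (v p))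
      simp only [add_apply, smul_apply, smul_eq_mul, ContinuousLinearMap.coe_fst']
      have e4 : (kflux f J p (w p) (v p)).1 = d p := rfl
      rw [e4]
      nlinarith
    have h1 := h0.trans (integral_mono hlhs hrhs hle)
    rw [Measure.volume_eq_prod, integral_prod _ hrhs] at h1
    refine h1.trans (le_of_eq ?_)
    congr 1
    funext t
    rw [hA, ← integral_const_mul]
    congr 1
    funext x
    simp only [smul_eq_mul]
    ring
  -- The first factor `e^{LT}`: at negative times the weight exceeds `exp(-√(1+|x|²))` by at most
  -- this much.
  have hexp : ∀ (R t : ℝ) (x : E N), -T ≤ t →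
      coneWeight L R (t, x) ≤ Real.exp (L * T) * Real.exp (-bracket x) := fun R t x ht => by
    refine (expCut_le _ _).trans ?_
    rw [← Real.exp_add]
    exact Real.exp_le_exp.2 (by simp only; nlinarith)
  have hAneg : ∀ R, ∀ᵐ t : ℝ, t ∈ Ioo (-T) 0 → A R t ≤ Real.exp (L * T) * B := fun R => by
    filter_upwards [hneg] with t ht hmem
    have hm : Measurable fun x => d (t, x) * coneWeight L R (t, x) :=
      (hdm.comp measurable_prodMk_left).mul ((hWc R).measurable.comp measurable_prodMk_left)
    rw [hA]
    simp only
    rw [integral_eq_lintegral_of_nonneg_ae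
      (Eventually.of_forall fun x => mul_nonneg (hd0 _) (hW0 _ _)) hm.aestronglyMeasurable]
    refine ENNReal.toReal_le_of_le_ofReal (by positivity) ?_
    calc ∫⁻ x, ENNReal.ofReal (d (t, x) * coneWeight L R (t, x))
        ≤ ∫⁻ x, ENNReal.ofReal (Real.exp (L * T))
            * ENNReal.ofReal (|w (t, x) - v (t, x)| * Real.exp (-bracket x)) := by
          refine lintegral_mono fun x => ?_
          rw [← ENNReal.ofReal_mul (Real.exp_nonneg _)]
          refine ENNReal.ofReal_le_ofReal ?_
          have := mul_le_mul_of_nonneg_left (hexp R t x hmem.1.le) (hd0 (t, x))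
          calc _ ≤ _ := this
            _ = _ := by rw [hddef]; ring
      _ = ENNReal.ofReal (Real.exp (L * T)) * ∫⁻ x,
            ENNReal.ofReal (|w (t, x) - v (t, x)| * Real.exp (-bracket x)) :=
          lintegral_const_mul' _ _ ENNReal.ofReal_ne_top
      _ ≤ ENNReal.ofReal (Real.exp (L * T)) * ENNReal.ofReal B := by
          gcongr
          exact ht hmem.2
      _ = _ := (ENNReal.ofReal_mul (Real.exp_nonneg _)).symm
  have hpos : ∀ n : ℕ, ∀ᵐ t : ℝ, t ∈ Ioo 0 T → A n t ≤ Real.exp (L * T) * B := fun n =>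
    ae_le_of_weakly_antitone hT (hAi n) (hweak n) (hAneg n)
  have hint : ∀ n : ℕ, ∀ᵐ t : ℝ, t ∈ Ioo 0 T →
      Integrable fun x => d (t, x) * coneWeight L n (t, x) := fun n => by
    have h1 := (integrable_prod_coneWeight (R := n) hL0 hd T).prod_right_ae
    rw [ae_restrict_iff' measurableSet_Icc] at h1
    filter_upwards [h1] with t ht hmem
    exact ht ⟨by linarith [hmem.1], hmem.2.le⟩
  filter_upwards [ae_all_iff.2 hpos, ae_all_iff.2 hint] with t h1 h2 hmem
  have hlim : ∀ x : E N, Tendsto (fun n : ℕ => ENNReal.ofReal (d (t, x) * coneWeight L n (t, x)))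
      atTop (𝓝 (ENNReal.ofReal (d (t, x) * Real.exp (-(bracket x + L * t))))) := fun x => by
    refine tendsto_const_nhds.congr' ?_
    -- The smooth transition equals 1 as soon as its argument reaches 1, so at each point the
    -- truncation is eventually inactive.
    filter_upwards [eventually_ge_atTop ⌈bracket x + L * t + 1⌉₊] with n hn
    have h3 : bracket x + L * t + 1 ≤ n := (Nat.le_ceil _).trans (by exact_mod_cast hn)
    simp only [coneWeight, expCut]
    rw [Real.smoothTransition.one_of_one_le (by linarith), mul_one]
  have hfatou : ∫⁻ x, ENNReal.ofReal (d (t, x) * Real.exp (-(bracket x + L * t)))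
      ≤ ENNReal.ofReal (Real.exp (L * T) * B) := by
    calc _ = ∫⁻ x, liminf (fun n : ℕ => ENNReal.ofReal (d (t, x) * coneWeight L n (t, x))) atTop :=
          lintegral_congr fun x => ((hlim x).liminf_eq).symm
      _ ≤ liminf (fun n : ℕ => ∫⁻ x, ENNReal.ofReal (d (t, x) * coneWeight L n (t, x))) atTop := by
          refine lintegral_liminf_le fun n => Measurable.ennreal_ofReal ?_
          exact (hdm.comp measurable_prodMk_left).mul
            ((hWc n).measurable.comp measurable_prodMk_left)
      _ ≤ _ := by
          refine liminf_le_of_le (by isBoundedDefault) fun b hb => ?_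
          obtain ⟨n, hn⟩ := hb.exists
          refine hn.trans ?_
          rw [← ofReal_integral_eq_lintegral_ofReal (h2 n hmem)
            (Eventually.of_forall fun x => mul_nonneg (hd0 _) (hW0 _ _))]
          exact ENNReal.ofReal_le_ofReal (h1 n hmem)
  -- Removing the factor `e^{-Lt}` from the weight costs the second `e^{LT}`.
  calc ∫⁻ x, ENNReal.ofReal (|w (t, x) - v (t, x)| * Real.exp (-bracket x))
      = ∫⁻ x, ENNReal.ofReal (Real.exp (L * t))
          * ENNReal.ofReal (d (t, x) * Real.exp (-(bracket x + L * t))) := by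
        refine lintegral_congr fun x => ?_
        rw [← ENNReal.ofReal_mul (Real.exp_nonneg _)]
        congr 1
        rw [neg_add, Real.exp_add, Real.exp_neg (L * t)]
        field_simp
        rfl
    _ = ENNReal.ofReal (Real.exp (L * t))
          * ∫⁻ x, ENNReal.ofReal (d (t, x) * Real.exp (-(bracket x + L * t))) :=
        lintegral_const_mul' _ _ ENNReal.ofReal_ne_top
    _ ≤ ENNReal.ofReal (Real.exp (L * T)) * ENNReal.ofReal (Real.exp (L * T) * B) := by
        gcongr
        exact hmem.2.le
    _ = ENNReal.ofReal (Real.exp (2 * L * T) * B) := by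
        rw [← ENNReal.ofReal_mul (Real.exp_nonneg _), ← mul_assoc, ← Real.exp_add]
        congr 3
        ring

/-! ### Regularity of the noise -/

/-- From `|x| ≤ 1 + x²` and variance `t`. A bound at each single time is enough, since the paths are
only integrated in time; no maximal inequality is needed. -/
theorem lintegral_enorm_brownian_le {Ω : Type*} [MeasurableSpace Ω] {P : Measure Ω}
    [IsProbabilityMeasure P] {X : ℝ≥0 → Ω → ℝ} (hX : IsBrownianReal X P) (t : ℝ≥0) :
    ∫⁻ ω, ‖X t ω‖ₑ ∂P ≤ ENNReal.ofReal (1 + t) := by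
  have h2 : MemLp (X t) 2 P := (hX.isGaussianProcess.hasGaussianLaw_eval t).memLp_two
  have hi := hX.integrable_eval t
  have hsq : ∫ ω, (X t ω) ^ 2 ∂P = t := by
    rw [← variance_of_integral_eq_zero hi.aemeasurable (hX.integral_eval t),
      ← covariance_self hi.aemeasurable, hX.covariance_eval, min_self]
  have hle : ∫ ω, ‖X t ω‖ ∂P ≤ 1 + t := by
    calc ∫ ω, ‖X t ω‖ ∂P ≤ ∫ ω, (1 + (X t ω) ^ 2) ∂P := by
          refine integral_mono hi.norm ((integrable_const 1).add h2.integrable_sq) fun ω => ?_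
          rw [Real.norm_eq_abs]
          nlinarith [sq_nonneg (|X t ω| - 1), sq_abs (X t ω)]
      _ = 1 + t := by
          rw [integral_add (integrable_const 1) h2.integrable_sq, hsq]
          simp
  rw [← ofReal_integral_norm_eq_lintegral_enorm hi]
  exact ENNReal.ofReal_le_ofReal hle

/-- Almost surely the paths are continuous and the weighted sum of the absolute values of the
Brownian motions is integrable in time. -/
theorem ae_continuous_and_lintegral_brownianSeq_lt_top {Ω : Type*} [MeasurableSpace Ω]
    {P : Measure Ω} [IsProbabilityMeasure P] {β : ℕ → ℝ≥0 → Ω → ℝ} (hβ : IsBrownianSeq P β)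
    {a : ℕ → ℝ} (ha0 : ∀ k, 0 ≤ a k) (ha : Summable a) (T : ℝ) :
    ∀ᵐ ω ∂P, (∀ k, Continuous fun t => β k t ω) ∧
      ∫⁻ t in Icc 0 T, ∑' k, ENNReal.ofReal (a k) * ‖β k t.toNNReal ω‖ₑ < ∞ := by
  have hcont : ∀ᵐ ω ∂P, ∀ k, Continuous fun t => β k t ω :=
    ae_all_iff.2 fun k => (hβ.brownian k).cont
  -- Path continuity holds only off a null set. Setting the processes to zero off a measurable set
  -- of full measure makes every path continuous, hence `γ` jointly measurable, as Tonelli requires.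
  set s : Set Ω := (toMeasurable P {ω | ¬ ∀ k, Continuous fun t => β k t ω})ᶜ with hs
  have hsm : MeasurableSet s := (measurableSet_toMeasurable _ _).compl
  have hsc : ∀ ω ∈ s, ∀ k, Continuous fun t => β k t ω := fun ω hω => by
    by_contra h
    exact hω (subset_toMeasurable P _ h)
  have hs1 : ∀ᵐ ω ∂P, ω ∈ s := by
    rw [ae_iff]
    simp only [hs, notMem_compl_iff, ofPred_mem_eq]
    rw [measure_toMeasurable]
    exact hcont
  let γ : ℕ → ℝ → Ω → ℝ := fun k t => s.indicator (β k t.toNNReal)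
  have hγc : ∀ k ω, Continuous fun t => γ k t ω := fun k ω => by
    by_cases hω : ω ∈ s
    · simp only [γ, indicator_of_mem hω]
      exact (hsc ω hω k).comp continuous_real_toNNReal
    · simp only [γ, indicator_of_notMem hω]
      exact continuous_const
  have hγm : ∀ k, Measurable fun z : ℝ × Ω => γ k z.1 z.2 := fun k =>
    measurable_uncurry_of_continuous_of_measurable (hγc k)
      fun t => (hβ.measurable k t.toNNReal).indicator hsm
  have hγs : ∀ k t, ∀ ω ∈ s, γ k t ω = β k t.toNNReal ω := fun k t ω hω => indicator_of_mem hω _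
  have hγle : ∀ k t ω, ‖γ k t ω‖ₑ ≤ ‖β k t.toNNReal ω‖ₑ := fun k t ω =>
    enorm_indicator_le_enorm_self _ _
  clear_value γ
  have hm : ∀ k, Measurable fun z : ℝ × Ω => ENNReal.ofReal (a k) * ‖γ k z.1 z.2‖ₑ := fun k =>
    measurable_const.mul (hγm k).enorm
  have hsum : Measurable fun z : ℝ × Ω => ∑' k, ENNReal.ofReal (a k) * ‖γ k z.1 z.2‖ₑ :=
    Measurable.tsum hm
  have hfin : ∫⁻ ω, (∫⁻ t in Icc 0 T, ∑' k, ENNReal.ofReal (a k) * ‖γ k t ω‖ₑ) ∂P ≠ ∞ := by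
    have hsum' : Measurable (Function.uncurry fun (ω : Ω) (t : ℝ) =>
        ∑' k, ENNReal.ofReal (a k) * ‖γ k t ω‖ₑ) := hsum.comp measurable_swap
    rw [lintegral_lintegral_swap hsum'.aemeasurable]
    have hle : ∀ t ∈ Icc (0 : ℝ) T, ∫⁻ ω, ∑' k, ENNReal.ofReal (a k) * ‖γ k t ω‖ₑ ∂P
        ≤ (∑' k, ENNReal.ofReal (a k)) * ENNReal.ofReal (1 + T) := fun t ht => by
      have hmt : ∀ k, Measurable fun ω => ENNReal.ofReal (a k) * ‖γ k t ω‖ₑ := fun k =>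
        ((hγm k).comp measurable_prodMk_left).enorm.const_mul _
      rw [lintegral_tsum fun k => (hmt k).aemeasurable,
        ← ENNReal.tsum_mul_right]
      refine ENNReal.tsum_le_tsum fun k => ?_
      rw [lintegral_const_mul' _ _ ENNReal.ofReal_ne_top]
      gcongr
      calc ∫⁻ ω, ‖γ k t ω‖ₑ ∂P ≤ ∫⁻ ω, ‖β k t.toNNReal ω‖ₑ ∂P :=
            lintegral_mono fun ω => hγle k t ω
        _ ≤ ENNReal.ofReal (1 + t.toNNReal) := lintegral_enorm_brownian_le (hβ.brownian k) _
        _ ≤ _ := by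
          rw [Real.coe_toNNReal _ ht.1]
          exact ENNReal.ofReal_le_ofReal (by linarith [ht.2])
    refine ne_top_of_le_ne_top ?_ (setLIntegral_mono' measurableSet_Icc hle)
    rw [setLIntegral_const, ← ENNReal.ofReal_tsum_of_nonneg ha0 ha]
    exact ENNReal.mul_ne_top (ENNReal.mul_ne_top ENNReal.ofReal_ne_top ENNReal.ofReal_ne_top)
      (by simp)
  have hmeas : Measurable fun ω => ∫⁻ t in Icc 0 T, ∑' k, ENNReal.ofReal (a k) * ‖γ k t ω‖ₑ := by
    have hsum' : Measurable fun z : Ω × ℝ => ∑' k, ENNReal.ofReal (a k) * ‖γ k z.2 z.1‖ₑ :=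
      hsum.comp measurable_swap
    exact hsum'.lintegral_prod_right'
  filter_upwards [hcont, hs1, ae_lt_top hmeas hfin] with ω h1 h2 h3
  refine ⟨h1, ?_⟩
  simpa only [hγs _ _ ω h2] using h3

theorem locallyIntegrable_comp_fst {m : ℝ → ℝ} (hm : Integrable m) :
    LocallyIntegrable fun p : ℝ × E N => m p.1 := fun p => by
  refine ⟨univ ×ˢ Metric.closedBall p.2 1,
    prod_mem_nhds univ_mem (Metric.closedBall_mem_nhds _ one_pos), ?_⟩
  have : IsFiniteMeasure (volume.restrict (Metric.closedBall p.2 1)) :=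
    ⟨by simpa using (isCompact_closedBall p.2 1).measure_lt_top⟩
  rw [IntegrableOn, Measure.volume_eq_prod, ← Measure.prod_restrict, Measure.restrict_univ]
  exact hm.comp_fst _

/-- Along a path for which the weighted sum is integrable in time, the noise has an
integrable-in-time spatial gradient. -/
theorem exists_hasSpatialGradient_noise {g : ℕ → E N → ℝ} (hg : ∀ k, ContDiff ℝ 1 (g k))
    {a : ℕ → ℝ} (ha0 : ∀ k, 0 ≤ a k) (hga : ∀ k x, |g k x| ≤ a k)
    (hga' : ∀ k x, ‖fderiv ℝ (g k) x‖ ≤ a k) {b : ℕ → ℝ → ℝ} (hb : ∀ k, Measurable (b k)) {T : ℝ}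
    (hfin : ∫⁻ t in Icc 0 T, ∑' k, ENNReal.ofReal (a k) * ‖b k t‖ₑ < ∞) :
    ∃ (J : ℝ × E N → ℝ) (G : ℝ × E N → E N) (m : ℝ → ℝ), HasSpatialGradient J G m ∧
      ∀ᵐ t : ℝ, t ∈ Icc 0 T → ∀ x, (∑' k, g k x * b k t) = J (t, x) ∧
        gradient (fun y => ∑' k, g k y * b k t) x = G (t, x) := by
  set σ : ℝ → ℝ≥0∞ := fun t => ∑' k, ENNReal.ofReal (a k) * ‖b k t‖ₑ with hσ
  have hσm : Measurable σ := Measurable.tsum fun k => measurable_const.mul (hb k).enorm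
  -- At times in `S` the series and its gradient converge uniformly in space; `J` and `G` are set to
  -- zero at all other times, so that their bounds hold everywhere.
  set S : Set ℝ := {t | t ∈ Icc 0 T ∧ σ t < ∞} with hS
  have hSm : MeasurableSet S := measurableSet_Icc.inter (measurableSet_lt hσm measurable_const)
  set m : ℝ → ℝ := S.indicator fun t => (σ t).toReal with hm
  have hsumm : ∀ t ∈ S, HasSum (fun k => a k * |b k t|) (m t) := fun t ht => by
    have h1 : ∀ k, (ENNReal.ofReal (a k) * ‖b k t‖ₑ).toReal = a k * |b k t| := fun k => by
      rw [ENNReal.toReal_mul, ENNReal.toReal_ofReal (ha0 k), toReal_enorm, Real.norm_eq_abs]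
    rw [hm, indicator_of_mem ht]
    have h2 := ENNReal.hasSum_toReal ht.2.ne
    rw [hσ]
    simp only [h1] at h2
    rwa [ENNReal.tsum_toReal_eq fun k => ENNReal.mul_ne_top ENNReal.ofReal_ne_top enorm_ne_top,
      tsum_congr h1]
  have hmi : Integrable m := by
    rw [hm, integrable_indicator_iff hSm]
    refine integrable_toReal_of_lintegral_ne_top hσm.aemeasurable
      (ne_top_of_le_ne_top hfin.ne (lintegral_mono_set fun t ht => ht.1))
  have hG0 : ∀ k x, HasGradientAt (g k) (gradient (g k) x) x := fun k x =>
    ((hg k).differentiable one_ne_zero x).hasGradientAt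
  have hGn : ∀ k x, ‖gradient (g k) x‖ ≤ a k := fun k x => by
    rw [gradient, LinearIsometryEquiv.norm_map]
    exact hga' k x
  have hGc : ∀ k, Continuous (gradient (g k)) := fun k =>
    (InnerProductSpace.toDual ℝ (E N)).symm.continuous.comp ((hg k).continuous_fderiv one_ne_zero)
  set J : ℝ × E N → ℝ := fun p => S.indicator (fun t => ∑' k, g k p.2 * b k t) p.1 with hJ
  set G : ℝ × E N → E N :=
    fun p => S.indicator (fun t => ∑' k, b k t • gradient (g k) p.2) p.1 with hG
  have hgrad : ∀ t ∈ S, ∀ x, HasGradientAt (fun y => ∑' k, g k y * b k t)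
      (∑' k, b k t • gradient (g k) x) x := fun t ht x => by
    have hsG : Summable fun k => b k t • gradient (g k) x :=
      Summable.of_norm_bounded (hsumm t ht).summable fun k => by
        rw [norm_smul, mul_comm, Real.norm_eq_abs]
        exact mul_le_mul_of_nonneg_right (hGn k x) (abs_nonneg _)
    have h1 := hasFDerivAt_tsum (𝕜 := ℝ) (f := fun k y => g k y * b k t)
      (f' := fun k y => b k t • fderiv ℝ (g k) y) (x₀ := 0) (hsumm t ht).summable
      (fun k y => ((hg k).differentiable one_ne_zero y).hasFDerivAt.mul_const (b k t))
      (fun k y => by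
        rw [norm_smul, mul_comm, Real.norm_eq_abs]
        exact mul_le_mul_of_nonneg_right (hga' k y) (abs_nonneg _))
      (Summable.of_norm_bounded (hsumm t ht).summable fun k => by
        rw [norm_mul, Real.norm_eq_abs, Real.norm_eq_abs]
        exact mul_le_mul_of_nonneg_right (hga k 0) (abs_nonneg _)) x
    rw [hasGradientAt_iff_hasFDerivAt]
    have h2 : InnerProductSpace.toDual ℝ (E N) (∑' k, b k t • gradient (g k) x)
        = ∑' k, b k t • fderiv ℝ (g k) x := by
      have h3 := (hsG.hasSum.mapL
        (InnerProductSpace.toDual ℝ (E N)).toContinuousLinearEquiv.toContinuousLinearMap)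
      refine (h3.congr_fun fun k => ?_).tsum_eq.symm
      simp [gradient]
    rw [h2]
    exact h1
  have hJm : Measurable J := by
    refine Measurable.indicator (f := fun p : ℝ × E N => ∑' k, g k p.2 * b k p.1)
      (Measurable.tsum fun k => ?_) (measurable_fst hSm)
    exact ((hg k).continuous.measurable.comp measurable_snd).mul ((hb k).comp measurable_fst)
  have hGm : Measurable G := by
    refine Measurable.indicator (f := fun p : ℝ × E N => ∑' k, b k p.1 • gradient (g k) p.2)
      (Measurable.tsum fun k => ?_) (measurable_fst hSm)
    exact ((hb k).comp measurable_fst).smul ((hGc k).measurable.comp measurable_snd)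
  have hm0 : ∀ t, 0 ≤ m t := fun t => indicator_nonneg (fun _ _ => ENNReal.toReal_nonneg) t
  have hJb : ∀ p, ‖J p‖ ≤ m p.1 := fun p => by
    by_cases hp : p.1 ∈ S
    · simp only [hJ, indicator_of_mem hp]
      refine tsum_of_norm_bounded (hsumm p.1 hp) fun k => ?_
      rw [norm_mul, Real.norm_eq_abs, Real.norm_eq_abs]
      exact mul_le_mul_of_nonneg_right (hga k _) (abs_nonneg _)
    · simp only [hJ, indicator_of_notMem hp, norm_zero, hm0]
  have hGb : ∀ p, ‖G p‖ ≤ m p.1 := fun p => by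
    by_cases hp : p.1 ∈ S
    · simp only [hG, indicator_of_mem hp]
      refine tsum_of_norm_bounded (hsumm p.1 hp) fun k => ?_
      rw [norm_smul, mul_comm, Real.norm_eq_abs]
      exact mul_le_mul_of_nonneg_right (hGn k _) (abs_nonneg _)
    · simp only [hG, indicator_of_notMem hp, norm_zero, hm0]
  have hml := locallyIntegrable_comp_fst (N := N) hmi
  have hmn : ∀ p : ℝ × E N, ‖m p.1‖ = m p.1 := fun p => Real.norm_of_nonneg (hm0 _)
  refine ⟨J, G, m, ⟨hJm, hml.mono hJm.aestronglyMeasurable (Eventually.of_forall fun p => by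
      rw [hmn]; exact hJb p), hGm, hml.mono hGm.aestronglyMeasurable
      (Eventually.of_forall fun p => by rw [hmn]; exact hGb p), hml,
      Eventually.of_forall fun t x => ?_, Eventually.of_forall fun t x => hGb (t, x)⟩, ?_⟩
  · by_cases ht : t ∈ S
    · simp only [hJ, hG, indicator_of_mem ht]
      exact hgrad t ht x
    · simp only [hJ, hG, indicator_of_notMem ht]
      exact hasGradientAt_const x 0
  · have hae := ae_lt_top hσm hfin.ne
    rw [ae_restrict_iff' measurableSet_Icc] at hae
    filter_upwards [hae] with t ht hmem x
    have htS : t ∈ S := ⟨hmem, ht hmem⟩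
    simp only [hJ, hG, indicator_of_mem htS, true_and]
    exact (hgrad t htS x).gradient

/-! ### From the entropy formulation to the space-time formulation -/

theorem locallyIntegrable_comp_snd {u₀ : E N → ℝ} (h : LocallyIntegrable u₀) :
    LocallyIntegrable fun p : ℝ × E N => u₀ p.2 := fun p => by
  refine ⟨Icc (p.1 - 1) (p.1 + 1) ×ˢ Metric.closedBall p.2 1, prod_mem_nhds
    (Icc_mem_nhds (by linarith) (by linarith)) (Metric.closedBall_mem_nhds _ one_pos), ?_⟩
  rw [IntegrableOn, Measure.volume_eq_prod, ← Measure.prod_restrict]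
  exact (h.integrableOn_isCompact (isCompact_closedBall p.2 1)).comp_snd _

/-- On a compact spatial set the L¹ norm of almost every time slice is at most a constant, and `[0,
T]` has finite length. -/
theorem locallyIntegrable_of_isEssBounded {T : ℝ} {u : ℝ → E N → ℝ} (h : IsEssBounded T u) :
    LocallyIntegrable ((Icc 0 T ×ˢ (univ : Set (E N))).indicator
      fun p : ℝ × E N => u p.1 p.2) := fun p => by
  refine ⟨univ ×ˢ Metric.closedBall p.2 1,
    prod_mem_nhds univ_mem (Metric.closedBall_mem_nhds _ one_pos), ?_⟩
  have hS : MeasurableSet (Icc 0 T ×ˢ (univ : Set (E N))) := measurableSet_Icc.prod .univ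
  rw [IntegrableOn, integrable_indicator_iff hS, IntegrableOn, Measure.restrict_restrict hS,
    prod_inter_prod, inter_univ, univ_inter, Measure.volume_eq_prod, ← Measure.prod_restrict]
  have hm : AEStronglyMeasurable (fun p : ℝ × E N => u p.1 p.2)
      ((volume.restrict (Icc 0 T)).prod (volume.restrict (Metric.closedBall p.2 1))) :=
    h.measurable.mono_ac (Measure.AbsolutelyContinuous.prod .rfl
      Measure.absolutelyContinuous_restrict)
  refine ⟨hm, ?_⟩
  obtain ⟨M, hM⟩ := h.loc _ (isCompact_closedBall p.2 1)
  rw [hasFiniteIntegral_iff_enorm, lintegral_prod _ hm.enorm]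
  refine (lintegral_mono_ae hM).trans_lt ?_
  rw [setLIntegral_const]
  exact ENNReal.mul_lt_top ENNReal.ofReal_lt_top (by simp)

theorem hasDerivAt_time_slice {φ : ℝ × E N → ℝ} (hφ : ContDiff ℝ (⊤ : ℕ∞) φ) (t : ℝ) (x : E N) :
    HasDerivAt (fun s => φ (s, x)) (fderiv ℝ φ (t, x) (1, 0)) t :=
  (hφ.differentiable (by simp) (t, x)).hasFDerivAt.comp_hasDerivAt t
    ((hasDerivAt_id t).prodMk (hasDerivAt_const t x))

theorem inner_gradient_space_slice {φ : ℝ × E N → ℝ} (hφ : ContDiff ℝ (⊤ : ℕ∞) φ) (t : ℝ)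
    (x c : E N) : inner ℝ c (gradient (fun y => φ (t, y)) x) = fderiv ℝ φ (t, x) (0, c) := by
  have h1 : HasFDerivAt (fun y => φ (t, y))
      ((fderiv ℝ φ (t, x)).comp (ContinuousLinearMap.inr ℝ ℝ (E N))) x :=
    (hφ.differentiable (by simp) (t, x)).hasFDerivAt.comp x
      ((hasFDerivAt_const t x).prodMk (hasFDerivAt_id x))
  rw [real_inner_comm, inner_gradient_left, h1.fderiv]
  simp

/-- The factor `k` does not depend on time, so integrating first in time leaves an exact derivative
of a compactly supported function. -/
theorem integral_mul_time_deriv_eq_zero {φ : ℝ × E N → ℝ} (hφ : ContDiff ℝ (⊤ : ℕ∞) φ)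
    (hφc : HasCompactSupport φ) {k : E N → ℝ} (hk : LocallyIntegrable k) :
    Integrable (fun p : ℝ × E N => k p.2 * fderiv ℝ φ p (1, 0)) ∧
      ∫ p : ℝ × E N, k p.2 * fderiv ℝ φ p (1, 0) = 0 := by
  have hφ' : Continuous (fderiv ℝ φ) := hφ.continuous_fderiv (by simp)
  have hc : Continuous fun p => fderiv ℝ φ p (1, 0) := hφ'.clm_apply continuous_const
  have hcs : HasCompactSupport fun p => fderiv ℝ φ p (1, 0) :=
    (hφc.fderiv (𝕜 := ℝ)).comp_left (g := fun A : (ℝ × E N) →L[ℝ] ℝ => A (1, 0)) (by simp)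
  have hi : Integrable (fun p : ℝ × E N => k p.2 * fderiv ℝ φ p (1, 0)) :=
    (locallyIntegrable_comp_snd hk).integrable_smul_right_of_hasCompactSupport hc hcs
  refine ⟨hi, ?_⟩
  rw [Measure.volume_eq_prod, integral_prod_symm _ hi]
  refine integral_eq_zero_of_ae (Eventually.of_forall fun x => ?_)
  simp only [Pi.zero_apply]
  rw [integral_const_mul]
  have hemb : Topology.IsClosedEmbedding fun t : ℝ => (t, x) :=
    (Isometry.of_dist_eq fun a b => by simp [Prod.dist_eq]).isClosedEmbedding
  rw [integral_eq_zero_of_hasDerivAt_of_integrable (fun t => hasDerivAt_time_slice hφ t x)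
    ((hc.comp hemb.continuous).integrable_of_hasCompactSupport (hcs.comp_isClosedEmbedding hemb))
    ((hφ.continuous.comp hemb.continuous).integrable_of_hasCompactSupport
      (hφc.comp_isClosedEmbedding hemb)), mul_zero]

/-- The extension by `u₀` to negative times absorbs the initial datum, because the term `|u₀ - α|
φ_t` integrates to zero over all of space-time. The function is also replaced by a measurable
representative, as doubling requires. -/
theorem exists_isKruzhkov {T : ℝ} {f : ℝ → E N} {L : ℝ≥0} (hf : ContDiff ℝ 1 f)
    (hL : LipschitzWith L f) {J : ℝ × E N → ℝ} {G : ℝ × E N → E N} {m : ℝ → ℝ}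
    (hJ : HasSpatialGradient J G m) {J' u : ℝ → E N → ℝ} {u₀ : E N → ℝ}
    (hJ' : ∀ᵐ t : ℝ, t ∈ Icc 0 T → ∀ x, J' t x = J (t, x) ∧ gradient (J' t) x = G (t, x))
    (hu₀ : LocallyIntegrable u₀) (hu : IsEssBounded T u) (hent : EntropyInequality T f u₀ J' u) :
    ∃ w : ℝ × E N → ℝ, Measurable w ∧ LocallyIntegrable w ∧ IsKruzhkov T f J G w ∧
      (∀ᵐ t : ℝ, t < 0 → ∀ᵐ x, w (t, x) = u₀ x) ∧
      ∀ᵐ t : ℝ, t ∈ Icc 0 T → ∀ᵐ x, w (t, x) = u t x - J (t, x) := by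
  have hS : MeasurableSet (Icc 0 T ×ˢ (univ : Set (E N))) := measurableSet_Icc.prod .univ
  have hS' : MeasurableSet (Iio (0 : ℝ) ×ˢ (univ : Set (E N))) := measurableSet_Iio.prod .univ
  -- Equal to `u₀` for `t < 0`, to `u - J` on `[0, T]` and to zero afterwards, where no test
  -- function reaches.
  set w' : ℝ × E N → ℝ := fun p =>
    (Iio (0 : ℝ) ×ˢ (univ : Set (E N))).indicator (fun p => u₀ p.2) p
      + ((Icc 0 T ×ˢ (univ : Set (E N))).indicator (fun p => u p.1 p.2) p
        - (Icc 0 T ×ˢ (univ : Set (E N))).indicator J p) with hw'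
  have hw'i : LocallyIntegrable w' :=
    ((locallyIntegrable_comp_snd hu₀).indicator hS').add
      ((locallyIntegrable_of_isEssBounded hu).sub (hJ.locallyIntegrable.indicator hS))
  have hsm := hw'i.aestronglyMeasurable
  set w : ℝ × E N → ℝ := hsm.mk w' with hwdef
  have hww' : w' =ᵐ[volume] w := hsm.ae_eq_mk
  have hwm : Measurable w := hsm.stronglyMeasurable_mk.measurable
  have hwi : LocallyIntegrable w := hw'i.congr hww'
  have hslice : ∀ᵐ t : ℝ, ∀ᵐ x, w (t, x) = w' (t, x) := by
    have h : ∀ᵐ p ∂((volume : Measure ℝ).prod (volume : Measure (E N))), w p = w' p := hww'.symm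
    exact Measure.ae_ae_of_ae_prod h
  have hneg : ∀ t < (0 : ℝ), ∀ x, w' (t, x) = u₀ x := fun t ht x => by
    have h1 : (t, x) ∈ Iio (0 : ℝ) ×ˢ (univ : Set (E N)) := ⟨ht, mem_univ _⟩
    have h2 : (t, x) ∉ Icc 0 T ×ˢ (univ : Set (E N)) := fun h => absurd h.1.1 (not_le.2 ht)
    simp only [hw', indicator_of_mem h1, indicator_of_notMem h2, sub_zero, add_zero]
  have hpos : ∀ t ∈ Icc (0 : ℝ) T, ∀ x, w' (t, x) = u t x - J (t, x) := fun t ht x => by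
    have h1 : (t, x) ∉ Iio (0 : ℝ) ×ˢ (univ : Set (E N)) := fun h => absurd ht.1 (not_le.2 h.1)
    have h2 : (t, x) ∈ Icc 0 T ×ˢ (univ : Set (E N)) := ⟨ht, mem_univ _⟩
    simp only [hw', indicator_of_notMem h1, indicator_of_mem h2, zero_add]
  refine ⟨w, hwm, hwi, ?_, ?_, ?_⟩
  · intro φ hφ hφc hφT hφ0 α
    have hφ' : Continuous (fderiv ℝ φ) := hφ.continuous_fderiv (by simp)
    set I : ℝ × E N → ℝ := fun p => fderiv ℝ φ p (kflux f J p (w p) α)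
      - Real.sign (w p - α) * source f J G p α * φ p with hI
    have hIi : Integrable I := by
      have hmaj1 : Integrable fun p : ℝ × E N =>
          ‖fderiv ℝ φ p‖ • ((1 + (L : ℝ)) * (|w p| + |α|)) :=
        (((locallyIntegrable_norm hwi).add (locallyIntegrable_const |α|)).smul
          (1 + (L : ℝ))).integrable_smul_left_of_hasCompactSupport hφ'.norm
          (hφc.fderiv (𝕜 := ℝ)).norm
      have hmaj2 : Integrable fun p : ℝ × E N => ‖φ p‖ • ((L : ℝ) * ‖G p‖) :=
        ((locallyIntegrable_norm hJ.locallyIntegrable_grad).smul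
          (L : ℝ)).integrable_smul_left_of_hasCompactSupport hφ.continuous.norm hφc.norm
      have hmI : Measurable I :=
        (measurable_clm_apply hφ'.measurable (measurable_kflux hf.continuous hJ.measurable
          measurable_id hwm measurable_const)).sub
          (((measurable_sign.comp (hwm.sub measurable_const)).mul (measurable_source hf
            hJ.measurable hJ.measurable_grad measurable_id measurable_const)).mul
            hφ.continuous.measurable)
      refine (hmaj1.add hmaj2).mono' hmI.aestronglyMeasurable (Eventually.of_forall fun p => ?_)
      refine (norm_sub_le _ _).trans (add_le_add ?_ ?_)
      · exact ContinuousLinearMap.le_opNorm_of_le _ (norm_kflux_le hL p _ _)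
      · rw [norm_mul, norm_mul, mul_comm]
        refine mul_le_mul_of_nonneg_left ?_ (norm_nonneg _)
        exact (mul_le_of_le_one_left (norm_nonneg _) (abs_sign_le_one _)).trans
          (abs_source_le hL p α)
    obtain ⟨h0i, h0⟩ := integral_mul_time_deriv_eq_zero hφ hφc (k := fun x => |u₀ x - α|)
      (locallyIntegrable_norm (hu₀.sub (locallyIntegrable_const α)))
    have hkey : ∫ p, I p = ∫ p, (I p - |u₀ p.2 - α| * fderiv ℝ φ p (1, 0)) := by
      rw [integral_sub hIi h0i, h0, sub_zero]
    rw [hkey, Measure.volume_eq_prod, integral_prod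
      (fun p : ℝ × E N => I p - |u₀ p.2 - α| * fderiv ℝ φ p (1, 0)) (hIi.sub h0i)]
    refine (hent φ hφ hφc hφT hφ0 α).trans (le_of_eq ?_)
    rw [← integral_indicator measurableSet_Icc]
    refine integral_congr_ae ?_
    have hsplit : ∀ (p : ℝ × E N) (s : ℝ) (c : E N), fderiv ℝ φ p (s, c)
        = s * fderiv ℝ φ p (1, 0) + fderiv ℝ φ p (0, c) := fun p s c => by
      rw [show (s, c) = s • ((1 : ℝ), (0 : E N)) + (0, c) by simp, map_add, map_smul, smul_eq_mul]
    filter_upwards [hslice, hJ'] with t ht1 ht2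
    by_cases ht : t ∈ Icc 0 T
    · rw [indicator_of_mem ht]
      refine integral_congr_ae ?_
      filter_upwards [ht1] with x hx
      obtain ⟨hx1, hx2⟩ := ht2 ht x
      have hhv : heav (t, x) = 1 := by simp [heav, ht.1]
      have hwx : w (t, x) = u t x - J (t, x) := hx.trans (hpos t ht x)
      simp only [hI, (hasDerivAt_time_slice hφ t x).deriv, hx1, hx2]
      rw [← real_inner_smul_left, inner_gradient_space_slice hφ]
      simp only [kflux, source, flux, hhv, one_smul, one_mul, hwx]
      rw [hsplit (t, x) |u t x - J (t, x) - α|]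
      ring
    · rw [indicator_of_notMem ht]
      symm
      refine integral_eq_zero_of_ae ?_
      filter_upwards [ht1] with x hx
      simp only [Pi.zero_apply]
      -- For `t < 0` the flux is off and `w = u₀`, so the subtracted `|u₀ - α| φ_t` cancels the
      -- integrand. Otherwise `t > T`, outside the support of `φ`.
      rcases lt_or_ge t 0 with h | h
      · have hhv : heav (t, x) = 0 := by simp [heav, h]
        simp only [hI, kflux, source, flux, hhv, zero_smul, sub_zero, smul_zero, zero_mul, mul_zero]
        rw [hsplit, hx, hneg t h x, show ((0 : ℝ), (0 : E N)) = 0 from rfl, map_zero]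
        ring
      · have hn : (t, x) ∉ tsupport φ := fun hmem => ht ⟨h, (hφT hmem).1.2.le⟩
        have h1 : φ (t, x) = 0 := image_eq_zero_of_notMem_tsupport hn
        have h2 : fderiv ℝ φ (t, x) = 0 :=
          image_eq_zero_of_notMem_tsupport fun hm => hn (tsupport_fderiv_subset ℝ hm)
        simp [hI, h1, h2]
  · filter_upwards [hslice] with t ht h
    filter_upwards [ht] with x hx
    rw [hx, hneg t h]
  · filter_upwards [hslice] with t ht h
    filter_upwards [ht] with x hx
    rw [hx, hpos t h]

/-! ### Stability and uniqueness -/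

/-- The exponential beats the power `N + 1`, one more than the dimension, so `(1 + |x|)^{-(N+1)}` is
an integrable majorant up to a constant. -/
theorem integrable_exp_neg_bracket : Integrable fun x : E N => Real.exp (-bracket x) := by
  have h1 : Integrable (fun x : E N => (1 + ‖x‖) ^ (-((N : ℝ) + 1))) :=
    integrable_one_add_norm (by simp)
  refine (h1.const_mul (Real.exp 1 * (N + 1).factorial)).mono'
    (contDiff_bracket.continuous.neg.rexp).aestronglyMeasurable
    (Eventually.of_forall fun x => ?_)
  have hx : 0 < 1 + ‖x‖ := by positivity
  have h2 := Real.pow_div_factorial_le_exp (1 + ‖x‖) hx.le (N + 1)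
  have h3 : (1 + ‖x‖) ^ (-((N : ℝ) + 1)) = ((1 + ‖x‖) ^ (N + 1))⁻¹ := by
    rw [Real.rpow_neg hx.le]
    norm_cast
  rw [h3, Real.norm_of_nonneg (Real.exp_pos _).le]
  calc Real.exp (-bracket x) ≤ Real.exp 1 * (Real.exp (1 + ‖x‖))⁻¹ := by
        rw [← Real.exp_neg, ← Real.exp_add]
        exact Real.exp_le_exp.2 (by linarith [norm_le_bracket x])
    _ ≤ Real.exp 1 * ((1 + ‖x‖) ^ (N + 1) / (N + 1).factorial)⁻¹ := by gcongr
    _ = _ := by rw [inv_div]; ring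

theorem integrable_abs_sub_mul_exp_neg_bracket {u₀ v₀ : E N → ℝ} (hu₀ : MemLp u₀ ∞)
    (hv₀ : MemLp v₀ ∞) : Integrable fun x => |u₀ x - v₀ x| * Real.exp (-bracket x) :=
  integrable_exp_neg_bracket.mul_of_top_right (hu₀.sub hv₀).norm

/-- Pathwise weighted `L¹` stability. -/
theorem lintegral_abs_sub_le {T : ℝ} (hT : 0 < T) {f : ℝ → E N} {L : ℝ≥0} (hf : ContDiff ℝ 1 f)
    (hL : LipschitzWith L f) {J : ℝ × E N → ℝ} {G : ℝ × E N → E N} {m : ℝ → ℝ}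
    (hJ : HasSpatialGradient J G m) {J' u v : ℝ → E N → ℝ} {u₀ v₀ : E N → ℝ}
    (hJ' : ∀ᵐ t : ℝ, t ∈ Icc 0 T → ∀ x, J' t x = J (t, x) ∧ gradient (J' t) x = G (t, x))
    (hu₀ : LocallyIntegrable u₀) (hv₀ : LocallyIntegrable v₀)
    (hi : Integrable fun x => |u₀ x - v₀ x| * Real.exp (-bracket x))
    (hu : IsEssBounded T u) (hv : IsEssBounded T v)
    (hue : EntropyInequality T f u₀ J' u) (hve : EntropyInequality T f v₀ J' v) :
    ∀ᵐ t ∂(volume.restrict (Icc 0 T)),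
      ∫⁻ x, ENNReal.ofReal (|u t x - v t x| * Real.exp (-bracket x)) ≤
        ENNReal.ofReal (Real.exp (2 * L * T) *
          ∫ x, |u₀ x - v₀ x| * Real.exp (-bracket x)) := by
  obtain ⟨w, hwm, hwi, hwK, hw0, hw1⟩ := exists_isKruzhkov hf hL hJ hJ' hu₀ hu hue
  obtain ⟨z, hzm, hzi, hzK, hz0, hz1⟩ := exists_isKruzhkov hf hL hJ hJ' hv₀ hv hve
  have hnn : ∀ x, 0 ≤ |u₀ x - v₀ x| * Real.exp (-bracket x) := fun x => by positivity
  have hmain := weighted_estimate (B := ∫ x, |u₀ x - v₀ x| * Real.exp (-bracket x)) hT hL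
    hJ.measurable hwm hwi hzm hzi
    (fun ψ h1 h2 h3 h4 => kato_inequality hf hL hJ hwm hwi hzm hzi hwK hzK h1 h2 h3 h4)
    (integral_nonneg hnn) (by
      filter_upwards [hw0, hz0] with t h1 h2 ht
      rw [ofReal_integral_eq_lintegral_ofReal hi (Eventually.of_forall hnn)]
      refine le_of_eq (lintegral_congr_ae ?_)
      filter_upwards [h1 ht, h2 ht] with x hx1 hx2
      rw [hx1, hx2])
  rw [← restrict_Ioo_eq_restrict_Icc, ae_restrict_iff' measurableSet_Ioo]
  filter_upwards [hmain, hw1, hz1] with t h1 h2 h3 ht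
  refine le_trans (le_of_eq (lintegral_congr_ae ?_)) (h1 ht)
  filter_upwards [h2 (Ioo_subset_Icc_self ht), h3 (Ioo_subset_Icc_self ht)] with x hx1 hx2
  rw [hx1, hx2]
  congr 3
  ring

/-- Weakly continuous functions that agree at almost every time agree at every time. -/
theorem IsWeaklyContinuous.ae_eq {T : ℝ} (hT : 0 < T) {u v : ℝ → E N → ℝ}
    (hu : IsWeaklyContinuous T u) (hv : IsWeaklyContinuous T v)
    (hui : ∀ t ∈ Icc 0 T, LocallyIntegrable (u t)) (hvi : ∀ t ∈ Icc 0 T, LocallyIntegrable (v t))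
    (h : ∀ᵐ t ∂(volume.restrict (Icc 0 T)), u t =ᵐ[volume] v t) :
    ∀ t ∈ Icc 0 T, u t =ᵐ[volume] v t := fun t ht => by
  refine ae_eq_of_integral_contDiff_smul_eq (hui t ht) (hvi t ht) fun ψ hψ hψc => ?_
  have hb : ∃ c, ∀ x, |ψ x| ≤ c := hψ.continuous.bounded_above_of_compact_support hψc
  have key := Measure.eqOn_Icc_of_ae_eq volume hT.ne (f := fun t => ∫ x, u t x * ψ x)
    (g := fun t => ∫ x, v t x * ψ x) (by
      filter_upwards [h] with s hs
      refine integral_congr_ae ?_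
      filter_upwards [hs] with x hx
      rw [hx]) (hu.loc ψ hψ.continuous.measurable hb hψc)
    (hv.loc ψ hψ.continuous.measurable hb hψc) ht
  simpa only [smul_eq_mul, mul_comm] using key

theorem IsNoiseCoeff.exists_summable_bound {g : ℕ → E N → ℝ} (hg : IsNoiseCoeff g) :
    ∃ a : ℕ → ℝ, (∀ k, 0 ≤ a k) ∧ Summable a ∧ (∀ k x, |g k x| ≤ a k) ∧
      ∀ k x, ‖fderiv ℝ (g k) x‖ ≤ a k := by
  obtain ⟨a, ha0, ha, hga⟩ := hg.bound
  refine ⟨a, fun k => (ha0 k).le, ha.of_nonneg_of_le (fun k => (ha0 k).le)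
    fun k => le_add_of_nonneg_right (sq_nonneg _), fun k x => ?_, fun k x => ?_⟩
  · linarith [hga k x, norm_nonneg (fderiv ℝ (g k) x),
      norm_nonneg (iteratedFDeriv ℝ 2 (g k) x)]
  · linarith [hga k x, abs_nonneg (g k x), norm_nonneg (iteratedFDeriv ℝ 2 (g k) x)]

/-- Randomness enters only through the almost sure set of admissible paths. The size of the noise
disappears in the Kato inequality, so the constant involves only `L` and `T`. -/
theorem ae_lintegral_abs_sub_le {Ω : Type*} [MeasurableSpace Ω] {P : Measure Ω}
    [IsProbabilityMeasure P] {T : ℝ} (hT : 0 < T) {f : ℝ → E N} {L : ℝ≥0} (hf : ContDiff ℝ 1 f)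
    (hL : LipschitzWith L f) {β : ℕ → ℝ≥0 → Ω → ℝ} (hβ : IsBrownianSeq P β)
    {g : ℕ → E N → ℝ} (hg : IsNoiseCoeff g) {u₀ v₀ : E N → ℝ} {u v : ℝ → Ω → E N → ℝ}
    (hu : IsBAPEntropySolution P β g f T u₀ u) (hv : IsBAPEntropySolution P β g f T v₀ v) :
    ∀ᵐ ω ∂P, ∀ᵐ t ∂(volume.restrict (Icc 0 T)),
      ∫⁻ x, ENNReal.ofReal (|u t ω x - v t ω x| * Real.exp (-bracket x)) ≤
        ENNReal.ofReal (Real.exp (2 * L * T) *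
          ∫ x, |u₀ x - v₀ x| * Real.exp (-bracket x)) := by
  obtain ⟨a, ha0, ha, hga, hga'⟩ := hg.exists_summable_bound
  filter_upwards [ae_continuous_and_lintegral_brownianSeq_lt_top hβ ha0 ha T, hu.ess_bounded,
    hv.ess_bounded, hu.entropy, hv.entropy] with ω ⟨hc, hfin⟩ hub hvb hue hve
  obtain ⟨J, G, m, hJ, hJ'⟩ := exists_hasSpatialGradient_noise
    (fun k => (hg.ap2 k).1.of_le one_le_two) ha0 hga hga'
    (b := fun k t => β k t.toNNReal ω)
    (fun k => ((hc k).comp continuous_real_toNNReal).measurable) hfin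
  exact lintegral_abs_sub_le hT hf hL hJ hJ' hu.init_bap.1 hv.init_bap.1
    (integrable_abs_sub_mul_exp_neg_bracket hu.init_bounded hv.init_bounded) hub hvb hue hve

theorem rhoStar_eq (x : E N) :
    rhoStar N x = (∫ y : E N, Real.exp (-bracket y))⁻¹ * Real.exp (-bracket x) := rfl

end BAP

end

/-! ### The stability theorem and pathwise uniqueness -/

theorem theoremT {N : ℕ} (hN : 1 ≤ N) (T : ℝ) (hT : 0 < T) (f : ℝ → BAP.E N)
    (hf : ContDiff ℝ 1 f) (hLip : ∃ L : ℝ≥0, LipschitzWith L f) :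
    ∃ C : ℝ, 0 < C ∧
      ∀ {Ω : Type*} [MeasurableSpace Ω] (P : Measure Ω) [IsProbabilityMeasure P]
        (β : ℕ → ℝ≥0 → Ω → ℝ) (_ : BAP.IsBrownianSeq P β)
        (g : ℕ → BAP.E N → ℝ) (_ : BAP.IsNoiseCoeff g)
        (u₀ v₀ : BAP.E N → ℝ) (u v : ℝ → Ω → BAP.E N → ℝ)
        (_ : BAP.IsBAPEntropySolution P β g f T u₀ u)
        (_ : BAP.IsBAPEntropySolution P β g f T v₀ v),
        (∀ᵐ ω ∂P, ∀ᵐ t ∂(volume.restrict (Icc 0 T)),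
          Integrable (fun x => |u t ω x - v t ω x| * BAP.rhoStar N x) volume ∧
          ∫ x, |u t ω x - v t ω x| * BAP.rhoStar N x ≤
            C * ∫ x, |u₀ x - v₀ x| * BAP.rhoStar N x) ∧
        (u₀ =ᵐ[volume] v₀ →
          ∀ᵐ ω ∂P, ∀ t ∈ Icc 0 T, u t ω =ᵐ[volume] v t ω) := by
  obtain ⟨L, hL⟩ := hLip
  refine ⟨Real.exp (2 * L * T), Real.exp_pos _, ?_⟩
  intro Ω _ P _ β hβ g hg u₀ v₀ u v hu hv
  have hest := BAP.ae_lintegral_abs_sub_le hT hf hL hβ hg hu hv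
  refine ⟨?_, fun h0 => ?_⟩
  -- Finiteness of the lower integral is proved first, since otherwise the Bochner integral on the
  -- left could be zero by default.
  · filter_upwards [hest, hu.mem, hv.mem] with ω hω hmu hmv
    filter_upwards [hω, ae_restrict_mem measurableSet_Icc] with t ht htT
    have hnn : ∀ x, 0 ≤ |u t ω x - v t ω x| * Real.exp (-BAP.bracket x) := fun x => by positivity
    have hi : Integrable fun x => |u t ω x - v t ω x| * Real.exp (-BAP.bracket x) := by
      refine ⟨((hmu t htT).1.aestronglyMeasurable.sub
        (hmv t htT).1.aestronglyMeasurable).norm.mul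
        BAP.integrable_exp_neg_bracket.aestronglyMeasurable, ?_⟩
      rw [hasFiniteIntegral_iff_ofReal (Eventually.of_forall hnn)]
      exact ht.trans_lt ENNReal.ofReal_lt_top
    have hle : ∫ x, |u t ω x - v t ω x| * Real.exp (-BAP.bracket x) ≤
        Real.exp (2 * L * T) * ∫ x, |u₀ x - v₀ x| * Real.exp (-BAP.bracket x) := by
      rw [← ofReal_integral_eq_lintegral_ofReal hi (Eventually.of_forall hnn)] at ht
      exact (ENNReal.ofReal_le_ofReal_iff (mul_nonneg (Real.exp_pos _).le
        (integral_nonneg fun x => by positivity))).1 ht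
    have hc : 0 ≤ (∫ y : BAP.E N, Real.exp (-BAP.bracket y))⁻¹ :=
      inv_nonneg.2 (integral_nonneg fun x => (Real.exp_pos _).le)
    simp only [BAP.rhoStar_eq, mul_left_comm _ (∫ y : BAP.E N, Real.exp (-BAP.bracket y))⁻¹]
    refine ⟨hi.const_mul _, ?_⟩
    rw [integral_const_mul, integral_const_mul, mul_left_comm]
    exact mul_le_mul_of_nonneg_left hle hc
  · filter_upwards [hest, hu.mem, hv.mem, hu.weakly_continuous, hv.weakly_continuous]
      with ω hω hmu hmv hcu hcv
    refine hcu.ae_eq hT hcv (fun t ht => (hmu t ht).1) (fun t ht => (hmv t ht).1) ?_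
    filter_upwards [hω, ae_restrict_mem measurableSet_Icc] with t ht htT
    have hB : ∫ x, |u₀ x - v₀ x| * Real.exp (-BAP.bracket x) = 0 := by
      refine integral_eq_zero_of_ae ?_
      filter_upwards [h0] with x hx
      simp [hx]
    have hm : AEMeasurable fun x => |u t ω x - v t ω x| * Real.exp (-BAP.bracket x) :=
      (((hmu t htT).1.aestronglyMeasurable.sub (hmv t htT).1.aestronglyMeasurable).norm.mul
        BAP.integrable_exp_neg_bracket.aestronglyMeasurable).aemeasurable
    rw [hB, mul_zero, ENNReal.ofReal_zero, nonpos_iff_eq_zero,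
      lintegral_eq_zero_iff' hm.ennreal_ofReal] at ht
    filter_upwards [ht] with x hx
    have h1 : |u t ω x - v t ω x| * Real.exp (-BAP.bracket x) ≤ 0 := ENNReal.ofReal_eq_zero.1 hx
    have h2 : |u t ω x - v t ω x| ≤ 0 := nonpos_of_mul_nonpos_left h1 (Real.exp_pos _)
    exact sub_eq_zero.1 (abs_nonpos_iff.1 h2)
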